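/- Let $\mathbb{F}_q$ be a finite field with $q$ elements. All polynomials below are monic elements of $\mathbb{F}_q[T]$; the letter $P$ denotes a monic irreducible polynomial (a prime), and $|A| = q^{\deg A}$ for $A \neq 0$. For a positive integer $k$ let $d_k(A)$ be the number of ordered $k$-tuples of monic polynomials with product $A$, and let $\Lambda(A) = \log |P|$ if $A = P^j$ for some prime $P$ and $j \geq 1$, and $\Lambda(A) = 0$ otherwise. For a Dirichlet character $\chi$ modulo a monic polynomial $R$ and an integer $X \geq 1$ put $$P_X(s,\chi) = \exp\Bigg( \sum_{\substack{A \text{ monic} \\ 1 \leq \deg A \leq X}} \frac{\chi(A)\Lambda(A)}{|A|^s \log |A|} \Bigg).$$ A character $\chi$ modulo $R$ is primitive if there is no monic divisor $S$ of $R$ with $\deg S < \deg R$ and character $\chi_1$ modulo $S$ such that $\chi(A) = \chi_1(A)$ for all $A \in \mathbb{F}_q[T]$ coprime to $R$. Let $\phi^*(R)$ be the number of primitive characters modulo $R$, and let $\sum^*$ denote a sum over them. **Theorem.** Fix $\mathbb{F}_q$ and a positive integer $k$. For every prime $P$ the series $\sum_{m \geq 0} d_k(P^m)^2 |P|^{-m}$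 converges, the product $$a(k) = \prod_{P} \Bigg( \bigg(1 - \frac{1}{|P|}\bigg)^{k^2} \sum_{m=0}^\infty \frac{d_k(P^m)^2}{|P|^m} \Bigg)$$ over all primes converges unconditionally, and $$\frac{1}{\phi^*(R)} \sideset{}{^*}\sum_{\chi \bmod R} \Big| P_X\Big(\frac12,\chi\Big) \Big|^{2k} \sim a(k) \Bigg[ \prod_{\substack{\deg P \leq X \\ P \mid R}} \Bigg( \sum_{m=0}^\infty \frac{d_k(P^m)^2}{|P|^m} \Bigg)^{-1} \Bigg] \big(e^{\gamma} X\big)^{k^2}$$ as $X, \deg R \to \infty$ with $X \leq \log_q \deg R$, where $X$ runs over the positive integers, $R$ runs over the monic polynomials with $\phi^*(R) \neq 0$, and $\gamma$ is the Euler-Mascheroni constant. (The limit is uniform in such pairs: for every $\varepsilon > 0$ there is $N = N(q,k,\varepsilon)$ such that the ratio of the two sides differs from $1$ by less than $\varepsilon$ whenever $X \geq N$, $\deg R \geq N$, $X \leq \log_q \deg R$ and $\phi^*(R) \neq 0$.) -/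

import Mathlib

open Polynomial Filter Asymptotics

noncomputable section

namespace FqPoly

variable {F : Type*} [Field F] [Fintype F]

/-- The norm `|A| = q ^ deg A` for `A ≠ 0`, and `|0| = 0`, as a real number. -/
def absV (A : F[X]) : ℝ := ((cardPowDegree A : ℤ) : ℝ)

variable (F) in
/-- Monic polynomials over `F`. -/
abbrev MonicPoly : Type _ := {A : F[X] // A.Monic}

variable (F) in
/-- Primes: monic irreducible polynomials over `F`. -/
abbrev PrimePoly : Type _ := {P : F[X] // P.Monic ∧ Irreducible P}

variable (F) in
theorem finite_monic_natDegree_le (X : ℕ) :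
    {A : F[X] | A.Monic ∧ A.natDegree ≤ X}.Finite := by
  have : Finite (degreeLT F (X + 1)) :=
    Finite.of_equiv _ (degreeLTEquiv F (X + 1)).toEquiv.symm
  refine Set.Finite.subset (Set.toFinite (degreeLT F (X + 1) : Set F[X])) ?_
  rintro A ⟨-, hA⟩
  rw [SetLike.mem_coe, mem_degreeLT]
  exact lt_of_le_of_lt degree_le_natDegree (by exact_mod_cast Nat.lt_succ_of_le hA)

variable (F) in
/-- The monic polynomials of degree at most `X`. -/
def monicsLE (X : ℕ) : Finset F[X] := (finite_monic_natDegree_le F X).toFinset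

open Classical in
variable (F) in
/-- The primes of degree at most `X`. -/
def primesLE (X : ℕ) : Finset F[X] := (monicsLE F X).filter Irreducible

open Classical in
/-- The von Mangoldt function: `log |P|` at a positive power of a prime `P`, and `0` elsewhere. -/
def vonMangoldt (A : F[X]) : ℝ :=
  if h : ∃ P : F[X], (P.Monic ∧ Irreducible P) ∧ ∃ j : ℕ, 0 < j ∧ A = P ^ j
  then Real.log (absV h.choose) else 0

/-- The `k`-fold divisor function on monic polynomials: the number of ordered `k`-tuples of monic
polynomials with product `A`. -/
def divisorFn (k : ℕ) (A : F[X]) : ℕ :=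
  Set.ncard {f : Fin k → F[X] | (∀ i, (f i).Monic) ∧ ∏ i, f i = A}

/-- Dirichlet characters modulo `R`: the multiplicative characters of `F[X] / (R)`
(zero at the non-units). -/
abbrev DirichletChar (R : F[X]) : Type _ := MulChar (F[X] ⧸ Ideal.span {R}) ℂ

/-- The value `χ(A)` of a Dirichlet character modulo `R` at a polynomial `A`. -/
def DirichletChar.eval {R : F[X]} (χ : DirichletChar R) (A : F[X]) : ℂ :=
  χ (Ideal.Quotient.mk (Ideal.span {R}) A)

/-- `S` is an induced modulus of `χ`: it is a monic divisor of `R`, and some character modulo `S`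
has the same values as `χ` on the polynomials coprime to `R`. -/
def DirichletChar.IsInducedModulus {R : F[X]} (χ : DirichletChar R) (S : F[X]) : Prop :=
  S.Monic ∧ S ∣ R ∧ ∃ χ₁ : DirichletChar S, ∀ A : F[X], IsCoprime A R → χ.eval A = χ₁.eval A

/-- `χ` is primitive: no induced modulus has degree strictly smaller than that of `R`. -/
def DirichletChar.IsPrimitive {R : F[X]} (χ : DirichletChar R) : Prop :=
  ¬ ∃ S : F[X], χ.IsInducedModulus S ∧ S.natDegree < R.natDegree

theorem finite_primitive (R : MonicPoly F) :
    {χ : DirichletChar R.1 | χ.IsPrimitive}.Finite := by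
  have := R.2.finite_quotient
  have : Finite (F[X] ⧸ Ideal.span {R.1}) := Module.finite_of_finite F
  exact Set.toFinite _

/-- The primitive characters modulo the monic polynomial `R`. -/
def primitiveChars (R : MonicPoly F) : Finset (DirichletChar R.1) := (finite_primitive R).toFinset

/-- The partial Euler product `P_X(s, χ)`. (The term at `A = 1` is `0`, since `Λ(1) = 0`.) -/
def partialEulerProduct (X : ℕ) (s : ℂ) {R : F[X]} (χ : DirichletChar R) : ℂ :=
  Complex.exp (∑ A ∈ monicsLE F X,
    χ.eval A * (vonMangoldt A : ℂ) / ((absV A : ℂ) ^ s * (Real.log (absV A) : ℂ)))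

/-- The average of `|P_X(1/2, χ)| ^ (2k)` over the primitive characters `χ` modulo `R`. -/
def eulerMoment (k X : ℕ) (R : MonicPoly F) : ℝ :=
  (1 / ((primitiveChars R).card : ℝ)) *
    ∑ χ ∈ primitiveChars R, ‖partialEulerProduct X (1 / 2) χ‖ ^ (2 * k)

/-- The general term `d_k(P^m)² / |P|^m` of the local series at `P`. -/
def localTerm (k : ℕ) (P : F[X]) (m : ℕ) : ℝ := (divisorFn k (P ^ m) : ℝ) ^ 2 / absV P ^ m

/-- The local series `∑ₘ d_k(P^m)² / |P|^m`. -/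
def localSeries (k : ℕ) (P : F[X]) : ℝ := ∑' m : ℕ, localTerm k P m

/-- The factor at `P` of the arithmetic factor `a(k)`. -/
def arithmeticTerm (k : ℕ) (P : F[X]) : ℝ := (1 - 1 / absV P) ^ (k ^ 2) * localSeries k P

variable (F) in
/-- The arithmetic factor `a(k)`, a product over all primes. -/
def arithmeticFactor (k : ℕ) : ℝ := ∏' P : PrimePoly F, arithmeticTerm k P.1

open Classical in
/-- The main term
`a(k) ∏_{deg P ≤ X, P ∣ R} (∑ₘ d_k(P^m)² / |P|^m)⁻¹ (e^γ X)^(k²)`. -/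
def mainTerm (k X : ℕ) (R : MonicPoly F) : ℝ :=
  arithmeticFactor F k * (∏ P ∈ (primesLE F X).filter (fun P => P ∣ R.1), (localSeries k P)⁻¹) *
    (Real.exp Real.eulerMascheroniConstant * X) ^ (k ^ 2)

variable (F) in
/-- The limit `X, deg R → ∞` over pairs of an integer `X` and a monic `R` with
`X ≤ log_q deg R` for which there is a primitive character modulo `R`. -/
def regime : Filter (ℕ × MonicPoly F) :=
  comap (fun p => (p.1, p.2.1.natDegree)) (atTop ×ˢ atTop) ⊓
    𝓟 {p | (p.1 : ℝ) ≤ Real.logb (Fintype.card F) p.2.1.natDegree ∧ (primitiveChars p.2).Nonempty}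

end FqPoly

end

/-! For each prime `P` of degree at most `X`, the local factor of `P_X(1/2, χ) ^ k` is the
exponential of a polynomial in `χ(P) |P|^(-1/2)`, hence entire. So `P_X(1/2, χ) ^ k` is an
absolutely convergent sum of `c(A) χ(A)`, with `c(A) ≥ 0`, over the polynomials `A` coprime to `R`
whose prime factors have degree at most `X`. Opening the square leaves a diagonal `∑ c(A)²` and
off-diagonal terms weighted by the average of `χ(A)` times the conjugate of `χ(B)` over primitive
`χ`.

Off the diagonal, `χ` is primitive iff for each prime `P ∣ R` it is nontrivial on the group of units
congruent to `1` modulo `R / P`. Detecting this by local weights shows that the average vanishes or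
is a product of factors of size about `1 / |P|` over a set of primes whose product times `A - B` is
divisible by `R`. It is therefore `O((|A - B| / |R|)^(1/4))` (`norm_sum_primitiveChars_le`). As `|A
- B| ≤ |A| |B|`, the double sum separates (Rankin's trick) and costs `exp(2k X q^(3X/4))
|R|^(-1/4)`, which tends to `0` because `q^X ≤ deg R` while `|R| = q^(deg R)`
(`abs_eulerMoment_sub_diagonalTerm_le`).

On the diagonal, the local coefficients equal `d_k(P^n)` as long as `n deg P ≤ X`. The diagonal is
thus the product of the full local series over `P ∤ R`, `deg P ≤ X`, up to a relative error bounded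
by a tail that does not depend on `R` (`one_sub_totalTail_le`). Mertens' theorem, which here reduces
to the harmonic numbers, turns that product into the main term (`tendsto_prod_localSeries_div`). -/

noncomputable section

namespace FqPoly

/-! ### Taylor coefficients of a truncated local factor -/

/-- The Taylor coefficients of `exp (k * ∑_{1 ≤ j ≤ J} z ^ j / j)`. -/
def expCoeff (k J : ℕ) : ℕ → ℝ
  | 0 => 1
  | n + 1 => k / (n + 1) * ∑ i : Fin (n + 1), if n - (i : ℕ) < J then expCoeff k J i else 0

theorem expCoeff_zero (k J : ℕ) : expCoeff k J 0 = 1 := by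
  rw [expCoeff]

theorem expCoeff_succ (k J n : ℕ) : expCoeff k J (n + 1) =
    k / (n + 1) * ∑ i ∈ Finset.range (n + 1), if n - i < J then expCoeff k J i else 0 := by
  rw [expCoeff, Finset.sum_range]

theorem expCoeff_nonneg (k J n : ℕ) : 0 ≤ expCoeff k J n := by
  induction n using Nat.strong_induction_on with
  | _ n ih =>
    cases n with
    | zero => rw [expCoeff_zero]; exact zero_le_one
    | succ n =>
      rw [expCoeff_succ]
      refine mul_nonneg (by positivity) (Finset.sum_nonneg fun i hi => ?_)
      split_ifs
      · exact ih i (Finset.mem_range.1 hi)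
      · exact le_rfl

/-- This is the recursion of `expCoeff` without truncation, as satisfied by the coefficients of `(1
- z)^(-k)`; it is the hockey-stick identity. Comparing the two recursions gives `expCoeff_le` and
`expCoeff_eq`. -/
theorem multichoose_succ_eq_sum (k n : ℕ) :
    ((k.multichoose (n + 1) : ℕ) : ℝ) =
      k / (n + 1) * ∑ i ∈ Finset.range (n + 1), (k.multichoose i : ℝ) := by
  rcases k with _ | k
  · simp
  have h1 : ∀ m, (k + 1).multichoose m = (m + k).choose k := fun m => by
    rw [Nat.multichoose_eq, show k + 1 + m - 1 = m + k by omega, Nat.choose_symm_add]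
  have h2 : ∑ i ∈ Finset.range (n + 1), (k + 1).multichoose i = (n + k + 1).choose (k + 1) := by
    simp_rw [h1]; exact Nat.sum_range_add_choose n k
  have h3 := Nat.choose_succ_right_eq (n + 1 + k) k
  rw [show n + 1 + k - k = n + 1 by omega, show n + 1 + k = n + k + 1 by omega] at h3
  rw [← Nat.cast_sum, h2, h1, show n + 1 + k = n + k + 1 by omega]
  rw [div_mul_eq_mul_div, eq_div_iff (by positivity)]
  have : (((n + k + 1).choose k * (n + 1) : ℕ) : ℝ) =
      ((n + k + 1).choose (k + 1) * (k + 1) : ℕ) := by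
    rw [h3]
  push_cast at this ⊢
  rw [this]; ring

theorem expCoeff_le (k J n : ℕ) : expCoeff k J n ≤ k.multichoose n := by
  induction n using Nat.strong_induction_on with
  | _ n ih =>
    cases n with
    | zero => simp [expCoeff_zero]
    | succ n =>
      rw [expCoeff_succ, multichoose_succ_eq_sum]
      refine mul_le_mul_of_nonneg_left (Finset.sum_le_sum fun i hi => ?_) (by positivity)
      split_ifs
      · exact ih i (Finset.mem_range.1 hi)
      · positivity

theorem expCoeff_eq {k J n : ℕ} (h : n ≤ J) : expCoeff k J n = k.multichoose n := by
  induction n using Nat.strong_induction_on with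
  | _ n ih =>
    cases n with
    | zero => simp [expCoeff_zero]
    | succ n =>
      rw [expCoeff_succ, multichoose_succ_eq_sum]
      congr 1
      refine Finset.sum_congr rfl fun i hi => ?_
      have := Finset.mem_range.1 hi
      rw [if_pos (by omega), ih i (by omega) (by omega)]

/-- The exponential `f` solves `f' = p f` with `p = k ∑_{j < J} z^j`. Leibniz' rule at `0` turns
this into the recursion defining `expCoeff`, and an entire function is the sum of its Taylor series
everywhere. -/
theorem hasSum_expCoeff (k J : ℕ) (z : ℂ) :
    HasSum (fun n => (expCoeff k J n : ℂ) * z ^ n)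
      (Complex.exp (k * ∑ j ∈ Finset.range J, z ^ (j + 1) / (j + 1))) := by
  set g : ℂ → ℂ := fun z => k * ∑ j ∈ Finset.range J, z ^ (j + 1) / (j + 1) with hg
  set f : ℂ → ℂ := fun z => Complex.exp (g z) with hf
  have hgd : ContDiff ℂ ⊤ g := by fun_prop
  have hfd : ContDiff ℂ ⊤ f := hgd.cexp
  set p : ℂ → ℂ := fun z => k * ∑ j ∈ Finset.range J, z ^ j with hp
  have hpd : ContDiff ℂ ⊤ p := by fun_prop
  have hderiv : deriv f = p * f := by
    funext w
    have h1 : HasDerivAt g (p w) w := by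
      refine HasDerivAt.const_mul _ (HasDerivAt.fun_sum fun j _ => ?_)
      refine ((hasDerivAt_pow (j + 1) w).div_const ((j : ℂ) + 1)).congr_deriv ?_
      have : (j : ℂ) + 1 ≠ 0 := by exact_mod_cast Nat.succ_ne_zero j
      rw [Nat.add_sub_cancel]; push_cast; exact mul_div_cancel_left₀ _ this
    simpa [mul_comm] using h1.cexp.deriv
  have hpi : ∀ i, iteratedDeriv i p 0 = if i < J then (k * i.factorial : ℂ) else 0 := by
    intro i
    rw [hp, iteratedDeriv_const_mul_field, iteratedDeriv_fun_sum (fun j _ => by fun_prop)]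
    simp_rw [iteratedDeriv_fun_pow_zero]
    simp [Finset.sum_ite_eq, mul_ite]
  have hc : ∀ n, iteratedDeriv n f 0 = n.factorial * (expCoeff k J n : ℂ) := by
    intro n
    induction n using Nat.strong_induction_on with
    | _ n ih =>
      cases n with
      | zero => simp [expCoeff_zero, hf, hg]
      | succ n =>
        rw [iteratedDeriv_succ', hderiv, iteratedDeriv_mul (hpd.contDiffAt.of_le le_top)
          (hfd.contDiffAt.of_le le_top), expCoeff_succ, ← Finset.sum_range_reflect, Nat.add_sub_cancel]
        push_cast
        rw [Nat.factorial_succ, Finset.mul_sum, Finset.mul_sum]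
        refine Finset.sum_congr rfl fun i hi => ?_
        have hi' := Finset.mem_range.1 hi
        rw [show n - (n - i) = i by omega, ih i hi', hpi]
        have hn : (n : ℂ) + 1 ≠ 0 := by exact_mod_cast Nat.succ_ne_zero n
        split_ifs
        · have h4 := Nat.choose_mul_factorial_mul_factorial (n := n) (k := n - i) (by omega)
          rw [show n - (n - i) = i by omega] at h4
          have h5 : (n.choose (n - i) : ℂ) * (n - i).factorial * i.factorial = n.factorial := by
            exact_mod_cast h4
          push_cast
          rw [← h5]
          field_simp
        · simp
  have := Complex.hasSum_taylorSeries_of_entire (f := f) (hfd.differentiable (by simp)) 0 z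
  refine this.congr_fun fun n => ?_
  rw [hc]
  have : (n.factorial : ℂ) ≠ 0 := by exact_mod_cast n.factorial_ne_zero
  simp; field_simp

theorem hasSum_expCoeff_real (k J : ℕ) (x : ℝ) :
    HasSum (fun n => expCoeff k J n * x ^ n)
      (Real.exp (k * ∑ j ∈ Finset.range J, x ^ (j + 1) / (j + 1))) := by
  have := hasSum_expCoeff k J x
  rw [← Complex.hasSum_ofReal]
  push_cast
  exact this

/-! ### Finite products of absolutely convergent series -/

theorem hasSum_pi_prod_option {α : Type*} [Fintype α] (f : Option α → ℕ → ℂ)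
    (hf : Summable fun n => ‖f none n‖) {a : ℂ}
    (h1 : Summable fun m : α → ℕ => ‖∏ i, f (some i) (m i)‖)
    (h2 : HasSum (fun m : α → ℕ => ∏ i, f (some i) (m i)) a) :
    (Summable fun m : Option α → ℕ => ‖∏ i, f i (m i)‖) ∧
      HasSum (fun m : Option α → ℕ => ∏ i, f i (m i)) ((∑' n, f none n) * a) := by
  set G : (α → ℕ) → ℂ := fun m => ∏ i, f (some i) (m i) with hG
  set F : ℕ × (α → ℕ) → ℂ := fun x => f none x.1 * G x.2 with hF
  have hs : Summable fun x => ‖F x‖ := by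
    have := hf.mul_of_nonneg h1 (fun _ => norm_nonneg _) (fun _ => norm_nonneg _)
    refine this.congr fun x => ?_
    rw [hF, norm_mul]
  have hsum : HasSum F ((∑' n, f none n) * a) := HasSum.mul hf.of_norm.hasSum h2 hs.of_norm
  have key : (fun m : Option α → ℕ => ∏ i, f i (m i)) =
      F ∘ (Equiv.piOptionEquivProd (β := fun _ => ℕ)) := by
    funext m
    rw [Fintype.prod_option]
    rfl
  have key' : (fun m : Option α → ℕ => ‖∏ i, f i (m i)‖) =
      (fun x => ‖F x‖) ∘ (Equiv.piOptionEquivProd (β := fun _ => ℕ)) := by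
    funext m
    exact congrArg norm (congrFun key m)
  rw [key, key']
  exact ⟨(Equiv.summable_iff _).2 hs, (Equiv.hasSum_iff _).2 hsum⟩

theorem hasSum_pi_prod_equiv {α β : Type*} [Fintype α] [Fintype β] (e : α ≃ β) (f : β → ℕ → ℂ)
    {a : ℂ} (h1 : Summable fun m : α → ℕ => ‖∏ i, f (e i) (m i)‖)
    (h2 : HasSum (fun m : α → ℕ => ∏ i, f (e i) (m i)) a) :
    (Summable fun m : β → ℕ => ‖∏ i, f i (m i)‖) ∧
      HasSum (fun m : β → ℕ => ∏ i, f i (m i)) a := by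
  have key : (fun m : β → ℕ => ∏ i, f i (m i)) =
      (fun m : α → ℕ => ∏ i, f (e i) (m i)) ∘ (e.symm.arrowCongr (Equiv.refl ℕ)) := by
    funext m
    exact (Equiv.prod_comp e fun i => f i (m i)).symm
  have key' : (fun m : β → ℕ => ‖∏ i, f i (m i)‖) =
      (fun m : α → ℕ => ‖∏ i, f (e i) (m i)‖) ∘ (e.symm.arrowCongr (Equiv.refl ℕ)) := by
    funext m
    exact congrArg norm (congrFun key m)
  rw [key, key']
  exact ⟨(Equiv.summable_iff _).2 h1, (Equiv.hasSum_iff _).2 h2⟩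

/-- A product of finitely many absolutely convergent series expands as a sum over tuples. -/
theorem hasSum_pi_prod {ι : Type*} [Fintype ι] (f : ι → ℕ → ℂ)
    (hf : ∀ i, Summable fun n => ‖f i n‖) :
    (Summable fun m : ι → ℕ => ‖∏ i, f i (m i)‖) ∧
      HasSum (fun m : ι → ℕ => ∏ i, f i (m i)) (∏ i, ∑' n, f i n) := by
  let P : ∀ (ι : Type _) [Fintype ι], Prop := fun ι _ => ∀ f : ι → ℕ → ℂ,
    (∀ i, Summable fun n => ‖f i n‖) → (Summable fun m : ι → ℕ => ‖∏ i, f i (m i)‖) ∧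
      HasSum (fun m : ι → ℕ => ∏ i, f i (m i)) (∏ i, ∑' n, f i n)
  have H : P ι := by
    apply Fintype.induction_empty_option (P := P)
    · intro α β _ e ih f hf
      let _ : Fintype α := Fintype.ofEquiv β e.symm
      obtain ⟨h1, h2⟩ := ih (fun i => f (e i)) fun i => hf _
      rw [← Equiv.prod_comp e fun i => ∑' n, f i n]
      exact hasSum_pi_prod_equiv e f h1 h2
    · intro f hf
      constructor
      · exact (hasSum_unique _).summable
      · convert hasSum_unique (fun m : PEmpty → ℕ => ∏ i, f i (m i)) using 1
        simp
    · intro α _ ih f hf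
      obtain ⟨h1, h2⟩ := ih (fun i => f (some i)) fun i => hf _
      rw [Fintype.prod_option]
      exact hasSum_pi_prod_option f (hf none) h1 h2
  exact H f hf

theorem hasSum_pi_prod_real {ι : Type*} [Fintype ι] (f : ι → ℕ → ℝ)
    (hf : ∀ i, Summable (f i)) :
    HasSum (fun m : ι → ℕ => ∏ i, f i (m i)) (∏ i, ∑' n, f i n) := by
  have := (hasSum_pi_prod (fun i n => (f i n : ℂ)) (fun i => by
    simpa using (hf i).norm)).2
  rw [← Complex.hasSum_ofReal]
  push_cast
  exact this

/-! ### Elementary inequalities and the second moment of a nearly orthogonal family -/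

theorem one_sub_sum_le_prod {ι : Type*} (s : Finset ι) (x : ι → ℝ) (h0 : ∀ i ∈ s, 0 ≤ x i)
    (h1 : ∀ i ∈ s, x i ≤ 1) : 1 - ∑ i ∈ s, x i ≤ ∏ i ∈ s, (1 - x i) := by
  classical
  induction s using Finset.induction_on with
  | empty => simp
  | insert a s ha ih =>
    rw [Finset.sum_insert ha, Finset.prod_insert ha]
    have h2 := ih (fun i hi => h0 i (Finset.mem_insert_of_mem hi))
      (fun i hi => h1 i (Finset.mem_insert_of_mem hi))
    have h3 : ∏ i ∈ s, (1 - x i) ≤ 1 := Finset.prod_le_one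
      (fun i hi => by linarith [h1 i (Finset.mem_insert_of_mem hi)])
      (fun i hi => by linarith [h0 i (Finset.mem_insert_of_mem hi)])
    have h4 := h0 a (Finset.mem_insert_self _ _)
    nlinarith

theorem one_sub_pow_bounds (K : ℕ) {r : ℝ} (h0 : 0 ≤ r) (h1 : r ≤ 1) :
    1 - K * r ≤ (1 - r) ^ K ∧ (1 - r) ^ K ≤ 1 - K * r + K ^ 2 * r ^ 2 := by
  induction K with
  | zero => simp
  | succ n ih =>
    obtain ⟨a, b⟩ := ih
    have hn : (0 : ℝ) ≤ n := n.cast_nonneg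
    rw [pow_succ]
    push_cast
    constructor
    · have := mul_le_mul_of_nonneg_right a (sub_nonneg.2 h1)
      nlinarith [mul_nonneg hn (mul_nonneg h0 h0)]
    · have := mul_le_mul_of_nonneg_right b (sub_nonneg.2 h1)
      have h3 : 0 ≤ (n : ℝ) ^ 2 * r ^ 3 := by positivity
      nlinarith [mul_nonneg hn (mul_nonneg h0 h0), mul_nonneg h0 h0]

/-- Nearly orthogonal unimodular families have nearly
diagonal second moment. -/
theorem abs_sum_normSq_sub_le {ι M : Type*} (s : Finset ι) (c W : M → ℝ) (v : ι → M → ℂ)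
    (Φ : ι → ℂ) {ε : ℝ} (hc : ∀ m, 0 ≤ c m) (hsc : Summable c)
    (hsW : Summable fun m => c m * W m) (hW : ∀ m, 0 ≤ W m) (hε : 0 ≤ ε)
    (hv : ∀ i ∈ s, ∀ m, ‖v i m‖ = 1)
    (hΦ : ∀ i ∈ s, HasSum (fun m => (c m : ℂ) * v i m) (Φ i))
    (horth : ∀ m m', m ≠ m' →
      ‖∑ i ∈ s, v i m * (starRingEnd ℂ) (v i m')‖ ≤ s.card * (ε * (W m * W m'))) :
    |∑ i ∈ s, ‖Φ i‖ ^ 2 - s.card * ∑' m, c m ^ 2| ≤ s.card * (ε * (∑' m, c m * W m) ^ 2) := by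
  classical
  have h1 : ∀ i ∈ s, HasSum (fun x : M × M => (c x.1 : ℂ) * c x.2 *
      (v i x.1 * (starRingEnd ℂ) (v i x.2))) ((‖Φ i‖ ^ 2 : ℝ) : ℂ) := by
    intro i hi
    have hn : (fun m => ‖(c m : ℂ) * v i m‖) = c := by
      funext m
      rw [norm_mul, hv i hi, mul_one, Complex.norm_real, Real.norm_of_nonneg (hc m)]
    have hn' : (fun m => ‖(c m : ℂ) * (starRingEnd ℂ) (v i m)‖) = c := by
      funext m
      rw [norm_mul, RCLike.norm_conj, hv i hi, mul_one, Complex.norm_real,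
        Real.norm_of_nonneg (hc m)]
    have hconj : HasSum (fun m => (c m : ℂ) * (starRingEnd ℂ) (v i m))
        ((starRingEnd ℂ) (Φ i)) := by
      have := Complex.hasSum_conj'.2 (hΦ i hi)
      refine this.congr_fun fun m => ?_
      rw [map_mul, Complex.conj_ofReal]
    have hs : Summable fun x : M × M =>
        ((c x.1 : ℂ) * v i x.1) * ((c x.2 : ℂ) * (starRingEnd ℂ) (v i x.2)) := by
      refine summable_mul_of_summable_norm (f := fun m => (c m : ℂ) * v i m)
        (g := fun m => (c m : ℂ) * (starRingEnd ℂ) (v i m)) ?_ ?_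
      · rw [hn]; exact hsc
      · rw [hn']; exact hsc
    have := (hΦ i hi).mul hconj hs
    rw [Complex.mul_conj, Complex.normSq_eq_norm_sq] at this
    refine this.congr_fun fun x => ?_
    ring
  have h2 : HasSum (fun x : M × M => (c x.1 : ℂ) * c x.2 *
      ∑ i ∈ s, v i x.1 * (starRingEnd ℂ) (v i x.2)) ((∑ i ∈ s, ‖Φ i‖ ^ 2 : ℝ) : ℂ) := by
    have := hasSum_sum h1
    rw [← Complex.ofReal_sum] at this
    refine this.congr_fun fun x => ?_
    rw [Finset.mul_sum]
  have hc2 : Summable fun m => c m ^ 2 := by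
    have := hsc.mul_of_nonneg hsc hc hc
    have := this.comp_injective (i := fun m : M => (m, m)) fun a b h => (Prod.ext_iff.1 h).1
    refine this.congr fun m => ?_
    simp [sq]
  -- The diagonal is written as a series over all pairs, so that it can be subtracted term by term
  -- from the double series; only off-diagonal terms then survive.
  have h3 : HasSum (fun x : M × M => if x.1 = x.2 then ((s.card * c x.1 ^ 2 : ℝ) : ℂ) else 0)
      ((s.card * ∑' m, c m ^ 2 : ℝ) : ℂ) := by
    have hinj : Function.Injective fun m : M => (m, m) := fun a b h => (Prod.ext_iff.1 h).1
    refine (hinj.hasSum_iff ?_).1 ?_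
    · rintro ⟨a, b⟩ hx
      refine if_neg fun h => hx ?_
      dsimp only at h
      exact ⟨a, by rw [h]⟩
    · have := (hc2.hasSum.mul_left (s.card : ℝ))
      rw [← Complex.hasSum_ofReal] at this
      refine this.congr_fun fun m => ?_
      simp
  have h4 := h2.sub h3
  have h5 : HasSum (fun x : M × M => (s.card : ℝ) * (ε * ((c x.1 * W x.1) * (c x.2 * W x.2))))
      (s.card * (ε * (∑' m, c m * W m) ^ 2)) := by
    have hs := hsW.mul_of_nonneg hsW (fun m => mul_nonneg (hc m) (hW m))
      fun m => mul_nonneg (hc m) (hW m)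
    rw [sq]
    exact ((hsW.hasSum.mul hsW.hasSum hs).mul_left ε).mul_left _
  rw [← Complex.ofReal_sub] at h4
  rw [← Real.norm_eq_abs, ← Complex.norm_real, ← h4.tsum_eq]
  refine tsum_of_norm_bounded h5 ?_
  · rintro ⟨a, b⟩
    dsimp only
    by_cases hab : a = b
    · subst hab
      have : ∑ i ∈ s, v i a * (starRingEnd ℂ) (v i a) = s.card := by
        rw [Finset.sum_congr rfl (g := fun _ => (1 : ℂ))]
        · simp
        · intro i hi
          rw [Complex.mul_conj, Complex.normSq_eq_norm_sq, hv i hi]; simp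
      rw [if_pos rfl, this]
      push_cast
      rw [show (c a : ℂ) * c a * s.card - s.card * (c a : ℂ) ^ 2 = 0 by ring, norm_zero]
      have := hc a
      have := hW a
      positivity
    · rw [if_neg hab, sub_zero, norm_mul, norm_mul, Complex.norm_real, Complex.norm_real,
        Real.norm_of_nonneg (hc a), Real.norm_of_nonneg (hc b)]
      calc c a * c b * ‖∑ i ∈ s, v i a * (starRingEnd ℂ) (v i b)‖
          ≤ c a * c b * (s.card * (ε * (W a * W b))) :=
            mul_le_mul_of_nonneg_left (horth a b hab) (mul_nonneg (hc a) (hc b))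
        _ = _ := by ring

/-! ### Characters of a finite ring that are nontrivial on prescribed subgroups -/

section Characters

open Classical in
theorem sum_mulChar_apply_eq {M : Type*} [CommMonoid M] [Finite M] [Fintype (MulChar M ℂ)] (a : M) :
    ∑ χ : MulChar M ℂ, χ a = if a = 1 then (Fintype.card (MulChar M ℂ) : ℂ) else 0 := by
  split_ifs with ha
  · simp [ha]
  · obtain ⟨χ, hχ⟩ := MulChar.exists_apply_ne_one_of_hasEnoughRootsOfUnity M ℂ ha
    refine eq_zero_of_mul_eq_self_left hχ ?_
    simp only [Finset.mul_sum, ← MulChar.mul_apply]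
    exact Fintype.sum_bijective _ (Group.mulLeft_bijective χ) _ _ fun χ' ↦ rfl

variable {Q : Type*} [CommRing Q]

/-- The units congruent to `1` modulo the annihilator of `p`. -/
def unitsFixing (p : Q) : Subgroup Qˣ where
  carrier := {u | p * u = p}
  one_mem' := by simp
  mul_mem' := by
    intro u v hu hv
    simp only [Set.mem_ofPred_eq] at *
    rw [Units.val_mul, ← mul_assoc, hu, hv]
  inv_mem' := by
    intro u hu
    simp only [Set.mem_ofPred_eq] at *
    rw [Units.mul_inv_eq_iff_eq_mul, hu]

theorem mem_unitsFixing {p : Q} {u : Qˣ} : u ∈ unitsFixing p ↔ p * u = p := Iff.rfl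

variable {ι : Type*} [Fintype ι]

omit [Fintype ι] in
theorem prod_mul_prod_eq_of_mem {p : ι → Q} {x : ι → Qˣ} (hx : ∀ i, x i ∈ unitsFixing (p i))
    (s : Finset ι) : (∏ i ∈ s, p i) * ((∏ i ∈ s, x i : Qˣ) : Q) = ∏ i ∈ s, p i := by
  rw [Units.coe_prod, ← Finset.prod_mul_distrib]
  exact Finset.prod_congr rfl fun i _ => hx i

/-- The subgroups are independent: multiplying by all `p j` with `j ≠ i` absorbs every component but
the `i`-th, and multiplying by `p i` absorbs that one. Coprimality combines both into the value of
the `i`-th component. -/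
theorem eq_of_prod_eq_of_mem_unitsFixing {p : ι → Q} (hp : Pairwise (Function.onFun IsCoprime p))
    {x y : ι → Qˣ} (hx : ∀ i, x i ∈ unitsFixing (p i)) (hy : ∀ i, y i ∈ unitsFixing (p i))
    (h : ∏ i, x i = ∏ i, y i) : x = y := by
  classical
  funext i
  have hD : ∀ z : ι → Qˣ, (∀ i, z i ∈ unitsFixing (p i)) →
      (∏ j ∈ Finset.univ.erase i, p j) * ((∏ j, z j : Qˣ) : Q) =
        (∏ j ∈ Finset.univ.erase i, p j) * z i := by
    intro z hz
    rw [← Finset.prod_erase_mul _ _ (Finset.mem_univ i), Units.val_mul, ← mul_assoc,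
      prod_mul_prod_eq_of_mem hz]
  have h1 : (∏ j ∈ Finset.univ.erase i, p j) * x i = (∏ j ∈ Finset.univ.erase i, p j) * y i := by
    rw [← hD x hx, ← hD y hy, h]
  have h2 : p i * x i = p i * y i := (hx i).trans (hy i).symm
  have hco : IsCoprime (p i) (∏ j ∈ Finset.univ.erase i, p j) :=
    IsCoprime.prod_right fun j hj => hp (Finset.ne_of_mem_erase hj).symm
  obtain ⟨a, b, hab⟩ := hco
  ext
  calc (x i : Q) = a * (p i * x i) + b * ((∏ j ∈ Finset.univ.erase i, p j) * x i) := by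
        linear_combination (-(x i : Q)) * hab
    _ = y i := by
        rw [h1, h2]; linear_combination (y i : Q) * hab

open Classical in
/-- The characters that are nontrivial on each of the subgroups `unitsFixing (p i)`. -/
def nontrivialChars [Fintype (MulChar Q ℂ)] (p : ι → Q) : Finset (MulChar Q ℂ) :=
  Finset.univ.filter fun χ => ∀ i, ∃ u ∈ unitsFixing (p i), χ (u : Q) ≠ 1

variable [Fintype Qˣ]

open Classical in
/-- The local weight whose transform detects the nontriviality of a character on
`unitsFixing p`. -/
def localWeight (p : Q) (u : Qˣ) : ℂ := (if u = 1 then 1 else 0) - 1 / Nat.card (unitsFixing p)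

open Classical in
/-- `unitsFixing p` as a finset. -/
def unitsFixingFinset (p : Q) : Finset Qˣ := Finset.univ.filter (· ∈ unitsFixing p)

theorem mem_unitsFixingFinset {p : Q} {u : Qˣ} :
    u ∈ unitsFixingFinset p ↔ u ∈ unitsFixing p := by
  simp [unitsFixingFinset]

theorem card_unitsFixingFinset (p : Q) :
    (unitsFixingFinset p).card = Nat.card (unitsFixing p) := by
  classical
  rw [unitsFixingFinset, Nat.card_eq_fintype_card, Fintype.card_subtype]

theorem card_unitsFixing_pos (p : Q) : 0 < Nat.card (unitsFixing p) := Nat.card_pos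

-- The weight is the point mass at `1` minus the uniform measure on the subgroup. The first
-- contributes `1`; the second contributes the mean of `χ`, which is `0` or `1`.
open Classical in
theorem sum_localWeight_mul (p : Q) (χ : MulChar Q ℂ) :
    ∑ u ∈ unitsFixingFinset p, localWeight p u * χ (u : Q) =
      if ∃ u ∈ unitsFixing p, χ (u : Q) ≠ 1 then 1 else 0 := by
  have h0 : (Nat.card (unitsFixing p) : ℂ) ≠ 0 := by
    exact_mod_cast (card_unitsFixing_pos p).ne'
  have h1 : ∑ u ∈ unitsFixingFinset p, (if u = 1 then (1 : ℂ) else 0) * χ (u : Q) = 1 := by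
    simp [mem_unitsFixingFinset, one_mem]
  simp_rw [localWeight, sub_mul, Finset.sum_sub_distrib]
  rw [h1, ← Finset.mul_sum]
  split_ifs with h
  · obtain ⟨v, hv, hv1⟩ := h
    have : ∑ u ∈ unitsFixingFinset p, χ (u : Q) = 0 := by
      refine eq_zero_of_mul_eq_self_left hv1 ?_
      rw [Finset.mul_sum]
      refine Finset.sum_bijective (fun u => v * u) (Group.mulLeft_bijective v) (fun u => ?_)
        (fun u _ => by rw [Units.val_mul, map_mul])
      rw [mem_unitsFixingFinset, mem_unitsFixingFinset, Subgroup.mul_mem_cancel_left _ hv]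
    rw [this]; simp
  · push Not at h
    rw [Finset.sum_congr rfl (fun u hu => h u (mem_unitsFixingFinset.1 hu)), Finset.sum_const,
      card_unitsFixingFinset, nsmul_eq_mul, mul_one, one_div, inv_mul_cancel₀ h0, sub_self]

variable [Finite Q] [Fintype (MulChar Q ℂ)]

-- Replace the indicator of each nontriviality condition by its transform `sum_localWeight_mul`,
-- expand the product, and apply orthogonality over all characters.
open Classical in
theorem sum_nontrivialChars_eq (p : ι → Q) (g : Qˣ) :
    ∑ χ ∈ nontrivialChars p, χ (g : Q) = (Fintype.card (MulChar Q ℂ) : ℂ) *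
      ∑ x ∈ Fintype.piFinset (fun i => unitsFixingFinset (p i)),
        if g * ∏ i, x i = 1 then ∏ i, localWeight (p i) (x i) else 0 := by
  have h1 : ∀ χ : MulChar Q ℂ, (if χ ∈ nontrivialChars p then χ (g : Q) else 0) =
      ∑ x ∈ Fintype.piFinset (fun i => unitsFixingFinset (p i)),
        (∏ i, localWeight (p i) (x i)) * χ ((g * ∏ i, x i : Qˣ) : Q) := by
    intro χ
    have h2 : (if χ ∈ nontrivialChars p then χ (g : Q) else 0) = χ (g : Q) *
        ∏ i, ∑ u ∈ unitsFixingFinset (p i), localWeight (p i) u * χ (u : Q) := by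
      simp_rw [sum_localWeight_mul]
      by_cases h : χ ∈ nontrivialChars p
      · have h' := h
        simp only [nontrivialChars, Finset.mem_filter, Finset.mem_univ, true_and] at h'
        rw [if_pos h, Finset.prod_eq_one fun i _ => if_pos (h' i), mul_one]
      · have h' := h
        simp only [nontrivialChars, Finset.mem_filter, Finset.mem_univ, true_and] at h'
        rw [not_forall] at h'
        obtain ⟨i, hi⟩ := h'
        rw [if_neg h, Finset.prod_eq_zero (Finset.mem_univ i) (if_neg hi), mul_zero]
    rw [h2, Finset.prod_univ_sum, Finset.mul_sum]
    refine Finset.sum_congr rfl fun x _ => ?_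
    rw [Units.val_mul, map_mul, Units.coe_prod, map_prod, Finset.prod_mul_distrib]
    ring
  calc ∑ χ ∈ nontrivialChars p, χ (g : Q)
      = ∑ χ : MulChar Q ℂ, if χ ∈ nontrivialChars p then χ (g : Q) else 0 := by
        rw [← Finset.sum_filter, Finset.filter_univ_mem]
    _ = _ := by
        rw [Finset.sum_congr rfl fun χ _ => h1 χ, Finset.sum_comm, Finset.mul_sum]
        refine Finset.sum_congr rfl fun x _ => ?_
        rw [← Finset.mul_sum, sum_mulChar_apply_eq]
        simp only [Units.val_eq_one]
        split_ifs <;> ring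

theorem card_nontrivialChars (p : ι → Q) (hp : Pairwise (Function.onFun IsCoprime p)) :
    ((nontrivialChars p).card : ℂ) = (Fintype.card (MulChar Q ℂ) : ℂ) *
      ∏ i, (1 - 1 / (Nat.card (unitsFixing (p i)) : ℂ)) := by
  classical
  have h := sum_nontrivialChars_eq p 1
  simp only [Units.val_one, map_one, Finset.sum_const, nsmul_eq_mul, mul_one, one_mul] at h
  rw [h]
  congr 1
  rw [Finset.sum_eq_single (1 : ι → Qˣ)]
  · simp [localWeight]
  · intro x hx hx1
    refine if_neg fun h => hx1 ?_
    rw [Fintype.mem_piFinset] at hx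
    refine eq_of_prod_eq_of_mem_unitsFixing hp (fun i => mem_unitsFixingFinset.1 (hx i))
      (fun i => one_mem _) ?_
    simpa using h
  · intro h
    refine absurd ?_ h
    rw [Fintype.mem_piFinset]
    exact fun i => mem_unitsFixingFinset.2 (one_mem _)

-- By independence at most one tuple `x` contributes. Dividing its weight by the count
-- `card_nontrivialChars`, a component `1` gives `1`, and any other gives modulus `(1/κ) / (1 - 1/κ)
-- = 1/(κ - 1)`, where `κ` is the order of the subgroup.
open Classical in
theorem sum_nontrivialChars_eq_zero_or (p : ι → Q) (hp : Pairwise (Function.onFun IsCoprime p))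
    (hne : (nontrivialChars p).Nonempty) (g : Qˣ) :
    ∑ χ ∈ nontrivialChars p, χ (g : Q) = 0 ∨ ∃ x : ι → Qˣ, (∀ i, x i ∈ unitsFixing (p i)) ∧
      g * ∏ i, x i = 1 ∧ ‖∑ χ ∈ nontrivialChars p, χ (g : Q)‖ =
        (nontrivialChars p).card *
          ∏ i, if x i = 1 then 1 else ((Nat.card (unitsFixing (p i)) : ℝ) - 1)⁻¹ := by
  by_cases hex : ∃ x : ι → Qˣ, (∀ i, x i ∈ unitsFixing (p i)) ∧ g * ∏ i, x i = 1
  · right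
    obtain ⟨x, hx, hgx⟩ := hex
    refine ⟨x, hx, hgx, ?_⟩
    have h1 : ∑ χ ∈ nontrivialChars p, χ (g : Q) = (Fintype.card (MulChar Q ℂ) : ℂ) *
        ∏ i, localWeight (p i) (x i) := by
      rw [sum_nontrivialChars_eq, Finset.sum_eq_single x, if_pos hgx]
      · intro y hy hyx
        refine if_neg fun h => hyx ?_
        rw [Fintype.mem_piFinset] at hy
        refine eq_of_prod_eq_of_mem_unitsFixing hp (fun i => mem_unitsFixingFinset.1 (hy i)) hx ?_
        exact mul_left_cancel (h.trans hgx.symm)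
      · intro h
        refine absurd ?_ h
        rw [Fintype.mem_piFinset]
        exact fun i => mem_unitsFixingFinset.2 (hx i)
    have h2 : ((nontrivialChars p).card : ℝ) = ‖((nontrivialChars p).card : ℂ)‖ := by simp
    rw [h1, h2, card_nontrivialChars p hp, norm_mul, norm_mul, mul_assoc, norm_prod, norm_prod,
      ← Finset.prod_mul_distrib]
    congr 1
    refine Finset.prod_congr rfl fun i _ => ?_
    have hκ : (1 : ℝ) ≤ Nat.card (unitsFixing (p i)) := by
      exact_mod_cast card_unitsFixing_pos (p i)
    -- On a subgroup of order one no character is nontrivial, contradicting `hne`.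
    have hκ' : (Nat.card (unitsFixing (p i)) : ℝ) ≠ 1 := by
      intro h
      obtain ⟨χ, hχ⟩ := hne
      have : ((nontrivialChars p).card : ℂ) ≠ 0 := by
        exact_mod_cast (Finset.card_pos.2 ⟨χ, hχ⟩).ne'
      rw [card_nontrivialChars p hp] at this
      refine this (mul_eq_zero_of_right _ (Finset.prod_eq_zero (Finset.mem_univ i) ?_))
      have h' : (Nat.card (unitsFixing (p i)) : ℂ) = 1 := by exact_mod_cast h
      rw [h']; norm_num
    by_cases hxi : x i = 1
    · simp [localWeight, hxi]
    · have h3 : (1 - 1 / (Nat.card (unitsFixing (p i)) : ℂ)) =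
          (((1 - 1 / (Nat.card (unitsFixing (p i)) : ℝ)) : ℝ) : ℂ) := by push_cast; rfl
      rw [localWeight, if_neg hxi, if_neg hxi, h3, Complex.norm_real, Real.norm_eq_abs,
        abs_of_nonneg (by rw [sub_nonneg, div_le_one (by linarith)]; exact hκ)]
      rw [zero_sub, norm_neg, norm_div, norm_one, Complex.norm_natCast]
      have : (Nat.card (unitsFixing (p i)) : ℝ) - 1 ≠ 0 := sub_ne_zero.2 hκ'
      field_simp
  · left
    rw [sum_nontrivialChars_eq, Finset.sum_eq_zero, mul_zero]
    intro x hx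
    rw [Fintype.mem_piFinset] at hx
    exact if_neg fun h => hex ⟨x, fun i => mem_unitsFixingFinset.1 (hx i), h⟩

end Characters

/-! ### The norm and the primes of the polynomial ring -/

variable {F : Type*} [Field F] [Fintype F]

theorem two_le_card : (2 : ℝ) ≤ Fintype.card F := by
  exact_mod_cast Fintype.one_lt_card (α := F)

theorem absV_eq {A : F[X]} (hA : A ≠ 0) : absV A = (Fintype.card F : ℝ) ^ A.natDegree := by
  rw [absV, cardPowDegree_nonzero A hA]; push_cast; rfl

theorem absV_pos {A : F[X]} (hA : A ≠ 0) : 0 < absV A := by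
  rw [absV_eq hA]
  have := two_le_card (F := F)
  positivity

theorem one_le_absV {A : F[X]} (hA : A ≠ 0) : 1 ≤ absV A := by
  rw [absV_eq hA]
  exact one_le_pow₀ (by linarith [two_le_card (F := F)])

theorem absV_mul (A B : F[X]) : absV (A * B) = absV A * absV B := by
  simp [absV]

theorem absV_pow (A : F[X]) (n : ℕ) : absV (A ^ n) = absV A ^ n := by
  simp [absV]

theorem absV_prod {ι : Type*} (s : Finset ι) (f : ι → F[X]) :
    absV (∏ i ∈ s, f i) = ∏ i ∈ s, absV (f i) := by
  simp [absV]

theorem absV_le_of_dvd {A B : F[X]} (h : A ∣ B) (hB : B ≠ 0) : absV A ≤ absV B := by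
  obtain ⟨C, rfl⟩ := h
  rw [absV_mul]
  exact le_mul_of_one_le_right (absV_pos (left_ne_zero_of_mul hB)).le
    (one_le_absV (right_ne_zero_of_mul hB))

/-- Bounding the difference by a product, rather than by a maximum, is what separates the variables
in the off-diagonal double sum. -/
theorem absV_sub_le_mul {A B : F[X]} (hA : A ≠ 0) (hB : B ≠ 0) (hAB : A ≠ B) :
    absV (A - B) ≤ absV A * absV B := by
  have hq : (1 : ℝ) ≤ Fintype.card F := by linarith [two_le_card (F := F)]
  rw [absV_eq hA, absV_eq hB, absV_eq (sub_ne_zero.2 hAB), ← pow_add]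
  refine pow_le_pow_right₀ hq ((natDegree_sub_le A B).trans ?_)
  omega

theorem mem_monicsLE {X : ℕ} {A : F[X]} : A ∈ monicsLE F X ↔ A.Monic ∧ A.natDegree ≤ X := by
  simp [monicsLE]

theorem mem_primesLE {X : ℕ} {P : F[X]} :
    P ∈ primesLE F X ↔ (P.Monic ∧ Irreducible P) ∧ P.natDegree ≤ X := by
  simp only [primesLE, Finset.mem_filter, mem_monicsLE]; tauto

theorem two_le_absV {P : F[X]} (hP : Irreducible P) : 2 ≤ absV P := by
  rw [absV_eq hP.ne_zero]
  calc (2 : ℝ) ≤ (Fintype.card F : ℝ) ^ 1 := by rw [pow_one]; exact two_le_card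
    _ ≤ _ := pow_le_pow_right₀ (by linarith [two_le_card (F := F)]) hP.natDegree_pos

omit [Fintype F] in
theorem eq_of_dvd_of_monic {P Q : F[X]} (hP : P.Monic) (hQ : Q.Monic) (hPi : Irreducible P)
    (hQi : Irreducible Q) (h : P ∣ Q) : P = Q :=
  eq_of_monic_of_associated hP hQ (hPi.associated_of_dvd hQi h)

open Classical in
/-- The primes dividing `R` (for `R ≠ 0`). -/
def primeDivisors (R : F[X]) : Finset F[X] := (primesLE F R.natDegree).filter (· ∣ R)

theorem mem_primeDivisors {R P : F[X]} (hR : R ≠ 0) :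
    P ∈ primeDivisors R ↔ (P.Monic ∧ Irreducible P) ∧ P ∣ R := by
  simp only [primeDivisors, Finset.mem_filter, mem_primesLE]
  exact ⟨fun h => ⟨h.1.1, h.2⟩, fun h => ⟨⟨h.1, natDegree_le_of_dvd h.2 hR⟩, h.2⟩⟩

/-! ### Units modulo `R` and a local criterion for primitivity -/

omit [Fintype F] in
theorem isUnit_mk_iff {R A : F[X]} :
    IsUnit (Ideal.Quotient.mk (Ideal.span {R}) A) ↔ IsCoprime A R := by
  rw [isUnit_iff_exists_inv]
  constructor
  · rintro ⟨b, hb⟩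
    obtain ⟨B, rfl⟩ := Ideal.Quotient.mk_surjective b
    rw [← map_mul, ← map_one (Ideal.Quotient.mk (Ideal.span {R})), Ideal.Quotient.eq,
      Ideal.mem_span_singleton'] at hb
    obtain ⟨c, hc⟩ := hb
    exact ⟨B, -c, by linear_combination -hc⟩
  · rintro ⟨a, b, hab⟩
    refine ⟨Ideal.Quotient.mk _ a, ?_⟩
    rw [← map_mul, ← map_one (Ideal.Quotient.mk (Ideal.span {R})), Ideal.Quotient.eq,
      Ideal.mem_span_singleton']
    exact ⟨-b, by linear_combination -hab⟩

omit [Fintype F] in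
theorem mk_eq_mk_iff {R A B : F[X]} : Ideal.Quotient.mk (Ideal.span {R}) A =
    Ideal.Quotient.mk (Ideal.span {R}) B ↔ R ∣ A - B := by
  rw [Ideal.Quotient.eq, Ideal.mem_span_singleton]

omit [Fintype F] in
theorem mem_unitsFixing_mk_iff {P S B : F[X]} (hP : P ≠ 0)
    {u : (F[X] ⧸ Ideal.span {P * S})ˣ} (hu : (u : F[X] ⧸ Ideal.span {P * S}) =
      Ideal.Quotient.mk (Ideal.span {P * S}) B) :
    u ∈ unitsFixing (Ideal.Quotient.mk (Ideal.span {P * S}) P) ↔ S ∣ B - 1 := by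
  rw [mem_unitsFixing, hu, ← map_mul, mk_eq_mk_iff,
    show P * B - P = P * (B - 1) by ring, mul_dvd_mul_iff_left hP]

-- A unit class `A` modulo `S` is lifted by `A` itself if `P ∤ A`, and otherwise by `A + S`, since
-- `P` cannot divide both `A` and `S`.
omit [Fintype F] in
theorem factor_units_surjective {P S : F[X]} (hP : Irreducible P) :
    Function.Surjective (Units.map (Ideal.Quotient.factor
      (Ideal.span_singleton_le_span_singleton.2 (Dvd.intro_left P rfl) :
        Ideal.span {P * S} ≤ Ideal.span {S})).toMonoidHom) := by
  intro v
  obtain ⟨A, hA⟩ := Ideal.Quotient.mk_surjective (v : F[X] ⧸ Ideal.span {S})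
  have hAS : IsCoprime A S := isUnit_mk_iff.1 (hA ▸ v.isUnit)
  suffices h : ∃ A' : F[X], IsCoprime A' (P * S) ∧ S ∣ A' - A by
    obtain ⟨A', h1, h2⟩ := h
    refine ⟨(isUnit_mk_iff.2 h1).unit, ?_⟩
    ext
    rw [Units.coe_map, IsUnit.unit_spec, ← hA]
    exact mk_eq_mk_iff.2 h2
  by_cases h : P ∣ A
  · refine ⟨A + S, IsCoprime.mul_right ?_ ?_, by simp⟩
    · refine ((hP.coprime_iff_not_dvd).2 fun h2 => ?_).symm
      exact hP.not_isUnit (hAS.isUnit_of_dvd' h ((dvd_add_right h).1 h2))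
    · simpa using hAS.add_mul_right_left 1
  · exact ⟨A, IsCoprime.mul_right ((hP.coprime_iff_not_dvd).2 h).symm hAS, by simp⟩

-- The units fixing `P` modulo `P * S` form the kernel of reduction modulo `S`, so a character
-- trivial on them factors through the surjection of unit groups.
omit [Fintype F] in
theorem isInducedModulus_of_trivial {P S : F[X]} (hP : Irreducible P) (hS : S.Monic)
    (χ : DirichletChar (P * S))
    (h : ∀ u ∈ unitsFixing (Ideal.Quotient.mk (Ideal.span {P * S}) P),
      χ (u : F[X] ⧸ Ideal.span {P * S}) = 1) :
    χ.IsInducedModulus S := by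
  set φ := Units.map (Ideal.Quotient.factor
      (Ideal.span_singleton_le_span_singleton.2 (Dvd.intro_left P rfl) :
        Ideal.span {P * S} ≤ Ideal.span {S})).toMonoidHom with hφ
  have hsurj : Function.Surjective φ := factor_units_surjective hP
  have hker : φ.ker ≤ χ.toUnitHom.ker := by
    intro u hu
    obtain ⟨B, hB⟩ := Ideal.Quotient.mk_surjective (u : F[X] ⧸ Ideal.span {P * S})
    have h1 : ((φ u : (F[X] ⧸ Ideal.span {S})ˣ) : F[X] ⧸ Ideal.span {S}) =
        Ideal.Quotient.mk (Ideal.span {S}) B := by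
      rw [hφ, Units.coe_map, ← hB]; rfl
    rw [MonoidHom.mem_ker] at hu ⊢
    rw [hu, Units.val_one, ← map_one (Ideal.Quotient.mk (Ideal.span {S}))] at h1
    ext
    rw [MulChar.coe_toUnitHom, Units.val_one]
    exact h u ((mem_unitsFixing_mk_iff hP.ne_zero hB.symm).2 (mk_eq_mk_iff.1 h1.symm))
  refine ⟨hS, Dvd.intro_left P rfl,
    MulChar.ofUnitHom (φ.liftOfSurjective hsurj ⟨χ.toUnitHom, hker⟩), fun A hA => ?_⟩
  have h2 : Ideal.Quotient.mk (Ideal.span {S}) A = (φ (isUnit_mk_iff.2 hA).unit :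
      F[X] ⧸ Ideal.span {S}) := by
    rw [hφ, Units.coe_map, IsUnit.unit_spec]; rfl
  rw [DirichletChar.eval, DirichletChar.eval, h2, MulChar.ofUnitHom_coe]
  have h3 := MonoidHom.liftOfRightInverse_comp_apply φ _
    (Function.rightInverse_surjInv hsurj) ⟨χ.toUnitHom, hker⟩ (isUnit_mk_iff.2 hA).unit
  rw [MonoidHom.liftOfSurjective, h3, MulChar.coe_toUnitHom, IsUnit.unit_spec]

/-- It suffices to test the maximal proper divisors `R / P`: a proper induced modulus `S` divides
some `R / P`, and a character induced from `S` is `1` on the units congruent to `1` modulo `R / P`.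
-/
theorem isPrimitive_iff {R : F[X]} (hR : R.Monic) (χ : DirichletChar R) :
    χ.IsPrimitive ↔ ∀ P : {P // P ∈ primeDivisors R},
      ∃ u ∈ unitsFixing (Ideal.Quotient.mk (Ideal.span {R}) P.1),
        χ (u : F[X] ⧸ Ideal.span {R}) ≠ 1 := by
  constructor
  · rintro h ⟨P, hP⟩
    rw [mem_primeDivisors hR.ne_zero] at hP
    obtain ⟨⟨hPm, hPi⟩, S, rfl⟩ := hP
    by_contra! h2
    have hS : S.Monic := hPm.of_mul_monic_left hR
    refine h ⟨S, isInducedModulus_of_trivial hPi hS χ h2, ?_⟩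
    rw [hPm.natDegree_mul hS]
    have := hPi.natDegree_pos
    omega
  · rintro h ⟨S, ⟨hS, ⟨T, rfl⟩, χ₁, hχ⟩, hdeg⟩
    have hT : T.Monic := hS.of_mul_monic_left hR
    rw [hS.natDegree_mul hT] at hdeg
    obtain ⟨P, hPm, hPi, T', rfl⟩ := Polynomial.exists_monic_irreducible_factor T
      (fun hu => by have := natDegree_eq_zero_of_isUnit hu; omega)
    obtain ⟨u, hu, hu1⟩ := h ⟨P, (mem_primeDivisors hR.ne_zero).2
      ⟨⟨hPm, hPi⟩, dvd_mul_of_dvd_right (dvd_mul_right _ _) _⟩⟩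
    refine hu1 ?_
    obtain ⟨B, hB⟩ := Ideal.Quotient.mk_surjective (u : F[X] ⧸ Ideal.span {S * (P * T')})
    rw [mem_unitsFixing, ← hB, ← map_mul, mk_eq_mk_iff,
      show P * B - P = P * (B - 1) by ring, show S * (P * T') = P * (S * T') by ring,
      mul_dvd_mul_iff_left hPi.ne_zero] at hu
    have h1 := hχ B (isUnit_mk_iff.1 (hB ▸ u.isUnit))
    rw [DirichletChar.eval, DirichletChar.eval, hB] at h1
    rw [h1, mk_eq_mk_iff.2 ((dvd_mul_right S T').trans hu), map_one, map_one]

theorem finite_quotient {R : F[X]} (hR : R.Monic) : Finite (F[X] ⧸ Ideal.span {R}) := by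
  have := hR.finite_quotient
  exact Module.finite_of_finite F

theorem card_quotient (P : F[X]) (hP : P.Monic) :
    (Nat.card (F[X] ⧸ Ideal.span {P}) : ℝ) = absV P := by
  have := hP.finite_quotient
  rw [Module.natCard_eq_pow_finrank (K := F), finrank_quotient_span_eq_natDegree,
    Nat.card_eq_fintype_card, absV_eq hP.ne_zero]
  push_cast; rfl

/-- The classes `1 + S t`, with `t` modulo `P`, are distinct modulo `P * S` and fix `P`. They are
units except when `1 + S t` vanishes modulo `P`, which happens for at most one `t`. -/
theorem absV_sub_one_le_card_unitsFixing {P S : F[X]} (hP : P.Monic) (hPi : Irreducible P)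
    (hS : S.Monic) : absV P - 1 ≤
      (Nat.card (unitsFixing (Ideal.Quotient.mk (Ideal.span {P * S}) P)) : ℝ) := by
  classical
  have : Finite (F[X] ⧸ Ideal.span {P * S}) :=
    finite_quotient (hP.mul hS)
  have : Finite (F[X] ⧸ Ideal.span {P}) := finite_quotient hP
  have hmax : (Ideal.span {P}).IsMaximal := PrincipalIdealRing.isMaximal_of_irreducible hPi
  let K := F[X] ⧸ Ideal.span {P}
  let _ : Field K := Ideal.Quotient.field _
  let _ : Fintype K := Fintype.ofFinite K
  choose rep hrep using Ideal.Quotient.mk_surjective (I := Ideal.span {P})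
  set s : K := Ideal.Quotient.mk (Ideal.span {P}) S with hs
  have hcop : ∀ t : K, 1 + s * t ≠ 0 → IsCoprime (1 + S * rep t) (P * S) := by
    intro t ht
    refine IsCoprime.mul_right ?_ ?_
    · refine ((hPi.coprime_iff_not_dvd).2 fun h => ht ?_).symm
      rw [← hrep t, hs, ← map_mul, ← map_one (Ideal.Quotient.mk (Ideal.span {P})), ← map_add,
        Ideal.Quotient.eq_zero_iff_mem, Ideal.mem_span_singleton]
      exact h
    · exact ⟨1, -rep t, by ring⟩
  let f : {t : K // 1 + s * t ≠ 0} → unitsFixing (Ideal.Quotient.mk (Ideal.span {P * S}) P) :=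
    fun t => ⟨(isUnit_mk_iff.2 (hcop t.1 t.2)).unit,
      (mem_unitsFixing_mk_iff hPi.ne_zero (IsUnit.unit_spec _)).2 (by simp)⟩
  have hf : Function.Injective f := by
    intro t t' h
    have h1 : (((f t).1 : (F[X] ⧸ Ideal.span {P * S})ˣ) : F[X] ⧸ Ideal.span {P * S}) =
        ((f t').1 : (F[X] ⧸ Ideal.span {P * S})ˣ) := by rw [h]
    simp only [f, IsUnit.unit_spec] at h1
    rw [mk_eq_mk_iff, show 1 + S * rep t.1 - (1 + S * rep t'.1) = S * (rep t.1 - rep t'.1) by ring,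
      mul_comm P S, mul_dvd_mul_iff_left hS.ne_zero] at h1
    ext
    rw [← hrep t.1, ← hrep t'.1]
    exact mk_eq_mk_iff.2 h1
  have h1 := Nat.card_le_card_of_injective f hf
  have h2 : Nat.card K ≤ Nat.card {t : K // 1 + s * t ≠ 0} + 1 := by
    rw [Nat.card_eq_fintype_card, Nat.card_eq_fintype_card, Fintype.card_subtype,
      ← Finset.card_univ, ← Finset.card_filter_add_card_filter_not (s := Finset.univ)
        (fun t : K => 1 + s * t ≠ 0)]
    refine Nat.add_le_add_left (Finset.card_le_one.2 fun a ha b hb => ?_) _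
    simp only [not_not, Finset.mem_filter, Finset.mem_univ, true_and] at ha hb
    have hs0 : s ≠ 0 := by
      rintro h0
      rw [h0, zero_mul, add_zero] at ha
      exact one_ne_zero ha
    exact mul_left_cancel₀ hs0 (by linear_combination ha - hb)
  have h3 := card_quotient P hP
  have h4 : (Nat.card K : ℝ) ≤
      (Nat.card (unitsFixing (Ideal.Quotient.mk (Ideal.span {P * S}) P)) : ℝ) + 1 := by
    exact_mod_cast h2.trans (Nat.add_le_add_right h1 1)
  linarith

theorem pairwise_isCoprime_primeDivisors {R : F[X]} (hR : R ≠ 0) :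
    Pairwise (Function.onFun IsCoprime fun P : {P // P ∈ primeDivisors R} =>
      Ideal.Quotient.mk (Ideal.span {R}) P.1) := by
  rintro ⟨P, hP⟩ ⟨Q, hQ⟩ hPQ
  rw [mem_primeDivisors hR] at hP hQ
  refine IsCoprime.map ?_ (Ideal.Quotient.mk (Ideal.span {R}))
  refine hP.1.2.coprime_iff_not_dvd.2 fun h => hPQ ?_
  exact Subtype.ext (eq_of_dvd_of_monic hP.1.1 hQ.1.1 hP.1.2 hQ.1.2 h)

theorem primitiveChars_eq (R : MonicPoly F) [Fintype (DirichletChar R.1)] :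
    primitiveChars R = nontrivialChars fun P : {P // P ∈ primeDivisors R.1} =>
      Ideal.Quotient.mk (Ideal.span {R.1}) P.1 := by
  ext χ
  rw [primitiveChars, Set.Finite.mem_toFinset, Set.mem_ofPred_eq, isPrimitive_iff R.2]
  simp only [nontrivialChars, Finset.mem_filter, Finset.mem_univ, true_and]

omit [Fintype F] in
theorem DirichletChar.eval_pow {R : F[X]} (χ : DirichletChar R) (A : F[X]) (n : ℕ) :
    χ.eval (A ^ n) = χ.eval A ^ n := by
  simp [DirichletChar.eval]

omit [Fintype F] in
theorem DirichletChar.eval_prod {R : F[X]} (χ : DirichletChar R) {ι : Type*} (s : Finset ι)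
    (f : ι → F[X]) : χ.eval (∏ i ∈ s, f i) = ∏ i ∈ s, χ.eval (f i) := by
  simp [DirichletChar.eval]

omit [Fintype F] in
theorem DirichletChar.eval_eq_zero {R : F[X]} (χ : DirichletChar R) {A : F[X]}
    (h : ¬ IsCoprime A R) : χ.eval A = 0 :=
  MulChar.map_nonunit _ fun h' => h (isUnit_mk_iff.1 h')

theorem DirichletChar.norm_eval {R : F[X]} (hR : R.Monic) (χ : DirichletChar R) {A : F[X]}
    (h : IsCoprime A R) : ‖χ.eval A‖ = 1 := by
  have := finite_quotient hR
  have : Fintype (F[X] ⧸ Ideal.span {R})ˣ := Fintype.ofFinite _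
  obtain ⟨u, hu⟩ := isUnit_mk_iff.2 h
  rw [DirichletChar.eval, ← hu]
  exact Complex.norm_eq_one_of_mem_rootsOfUnity (χ.apply_mem_rootsOfUnity u)

/-! ### Approximate orthogonality of primitive characters -/

/-- The exceptional factor of the primes of degree one in `norm_sum_primitiveChars_le`. -/
def linearPrimesFactor (F : Type*) [Field F] [Fintype F] : ℝ :=
  ((Fintype.card F : ℝ) ^ (1 / 4 : ℝ)) ^ (primesLE F 1).card

theorem linearPrimesFactor_pos : 0 < linearPrimesFactor F := by
  have := two_le_card (F := F)
  unfold linearPrimesFactor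
  positivity

theorem rpow_quarter_le_half {y : ℝ} (hy : 4 ≤ y) : y ^ (1 / 4 : ℝ) ≤ y / 2 := by
  have h0 : 0 ≤ y := by linarith
  have h1 : (y ^ (1 / 4 : ℝ)) ^ 4 = y := by
    rw [← Real.rpow_natCast, ← Real.rpow_mul h0]; norm_num
  have h2 : 0 ≤ y ^ (1 / 4 : ℝ) := Real.rpow_nonneg h0 _
  set t := y ^ (1 / 4 : ℝ)
  have h3 : 2 ≤ t ^ 2 := by
    by_contra! h
    nlinarith [sq_nonneg t, mul_self_nonneg (t ^ 2)]
  have h4 : 1 ≤ t := by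
    by_contra! h
    nlinarith
  nlinarith [mul_nonneg (sub_nonneg.2 h3) (sq_nonneg t), mul_nonneg h2 (sub_nonneg.2 h4)]

/-- For degree at least two, `|P| ≥ 4` and the group order minus one is at least `|P| - 2 ≥ |P| / 2
≥ |P|^(1/4)`. For degree one this may fail, but the nontrivial `x` makes the order at least `2`, and
the factor `q^(1/4)` compensates for `|P|^(-1/4)`. -/
theorem inv_card_unitsFixing_sub_one_le {P R : F[X]} (hP : P.Monic) (hPi : Irreducible P)
    (hR : R.Monic) (hPR : P ∣ R) {x : (F[X] ⧸ Ideal.span {R})ˣ}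
    (hx : x ∈ unitsFixing (Ideal.Quotient.mk (Ideal.span {R}) P)) (hx1 : x ≠ 1) :
    ((Nat.card (unitsFixing (Ideal.Quotient.mk (Ideal.span {R}) P)) : ℝ) - 1)⁻¹ ≤
      (if P.natDegree = 1 then (Fintype.card F : ℝ) ^ (1 / 4 : ℝ) else 1) *
        (absV P ^ (1 / 4 : ℝ))⁻¹ := by
  have hfin := finite_quotient hR
  obtain ⟨S, rfl⟩ := hPR
  have hS : S.Monic := hP.of_mul_monic_left hR
  set κ := Nat.card (unitsFixing (Ideal.Quotient.mk (Ideal.span {P * S}) P)) with hκ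
  have hκ2 : 2 ≤ κ := by
    have : Nontrivial (unitsFixing (Ideal.Quotient.mk (Ideal.span {P * S}) P)) :=
      ⟨⟨⟨x, hx⟩, 1, fun h => hx1 (congrArg Subtype.val h)⟩⟩
    exact Finite.one_lt_card
  have hκ2' : (2 : ℝ) ≤ κ := by exact_mod_cast hκ2
  have hq := two_le_card (F := F)
  have hpos := absV_pos hPi.ne_zero
  split_ifs with hdeg
  · rw [absV_eq hPi.ne_zero, hdeg, pow_one, mul_inv_cancel₀ (by positivity)]
    exact inv_le_one_of_one_le₀ (by linarith)
  · rw [one_mul]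
    have h4 : 4 ≤ absV P := by
      have := hPi.natDegree_pos
      rw [absV_eq hPi.ne_zero]
      calc (4 : ℝ) ≤ (Fintype.card F : ℝ) ^ 2 := by nlinarith
        _ ≤ _ := pow_le_pow_right₀ (by linarith) (by omega)
    have h5 := absV_sub_one_le_card_unitsFixing hP hPi hS
    have h6 := rpow_quarter_le_half h4
    refine inv_anti₀ (by positivity) ?_
    rw [← hκ] at h5
    linarith

theorem norm_sum_primitiveChars_le (R : MonicPoly F) {A B : F[X]} (hA : IsCoprime A R.1)
    (hB : IsCoprime B R.1) (hAB : A ≠ B) :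
    ‖∑ χ ∈ primitiveChars R, χ.eval A * (starRingEnd ℂ) (χ.eval B)‖ ≤
      (primitiveChars R).card *
        (linearPrimesFactor F * (absV (A - B) / absV R.1) ^ (1 / 4 : ℝ)) := by
  classical
  obtain ⟨R, hR⟩ := R
  have hq := two_le_card (F := F)
  have hCpos := linearPrimesFactor_pos (F := F)
  have hfin := finite_quotient hR
  have : Fintype (DirichletChar R) := Fintype.ofFinite _
  have : Fintype (F[X] ⧸ Ideal.span {R})ˣ := Fintype.ofFinite _
  have hnonneg : 0 ≤ linearPrimesFactor F * (absV (A - B) / absV R) ^ (1 / 4 : ℝ) :=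
    mul_nonneg hCpos.le (Real.rpow_nonneg (div_nonneg (absV_pos (sub_ne_zero.2 hAB)).le
      (absV_pos hR.ne_zero).le) _)
  obtain ⟨a, ha⟩ := isUnit_mk_iff.2 hA
  obtain ⟨b, hb⟩ := isUnit_mk_iff.2 hB
  have hsum : ∑ χ ∈ primitiveChars ⟨R, hR⟩, χ.eval A * (starRingEnd ℂ) (χ.eval B) =
      ∑ χ ∈ nontrivialChars fun P : {P // P ∈ primeDivisors R} =>
        Ideal.Quotient.mk (Ideal.span {R}) P.1, χ ((a * b⁻¹ : (F[X] ⧸ Ideal.span {R})ˣ) :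
          F[X] ⧸ Ideal.span {R}) := by
    rw [primitiveChars_eq]
    refine Finset.sum_congr rfl fun χ _ => ?_
    rw [DirichletChar.eval, DirichletChar.eval, ← ha, ← hb, Units.val_mul, map_mul,
      starRingEnd_apply, MulChar.star_apply', MulChar.inv_apply, Ring.inverse_unit]
  rw [hsum, primitiveChars_eq]
  rcases Finset.eq_empty_or_nonempty (nontrivialChars fun P : {P // P ∈ primeDivisors R} =>
    Ideal.Quotient.mk (Ideal.span {R}) P.1) with hne | hne
  · rw [hne]; simp
  rcases sum_nontrivialChars_eq_zero_or _ (pairwise_isCoprime_primeDivisors hR.ne_zero) hne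
    (a * b⁻¹) with h | ⟨x, hx, hgx, h⟩
  · rw [h, norm_zero]
    exact mul_nonneg (Nat.cast_nonneg _) hnonneg
  rw [h]
  refine mul_le_mul_of_nonneg_left ?_ (Nat.cast_nonneg _)
  set bad : Finset {P // P ∈ primeDivisors R} := Finset.univ.filter fun P => x P ≠ 1 with hbad
  have hP : ∀ P : {P // P ∈ primeDivisors R}, (P.1.Monic ∧ Irreducible P.1) ∧ P.1 ∣ R :=
    fun P => (mem_primeDivisors hR.ne_zero).1 P.2
  have hprod : ∏ P, x P = ∏ P ∈ bad, x P := by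
    refine (Finset.prod_subset (Finset.subset_univ _) fun P _ hP => ?_).symm
    by_contra h1
    exact hP (Finset.mem_filter.2 ⟨Finset.mem_univ _, h1⟩)
  -- Multiplying by the bad primes absorbs the components relating `A` to `B`, so `A` and `B` become
  -- congruent. Thus `|A - B|` can be small only if the bad primes have a large product.
  have hdvd : R ∣ (∏ P ∈ bad, P.1) * (A - B) := by
    have h1 := prod_mul_prod_eq_of_mem hx bad
    have h2 : a * ∏ P ∈ bad, x P = b := by
      rw [hprod] at hgx
      rw [← mul_one b, ← hgx]
      rw [mul_comm a b⁻¹, mul_assoc, mul_inv_cancel_left]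
    have h3 : (∏ P ∈ bad, Ideal.Quotient.mk (Ideal.span {R}) P.1) *
        Ideal.Quotient.mk (Ideal.span {R}) A =
        (∏ P ∈ bad, Ideal.Quotient.mk (Ideal.span {R}) P.1) *
        Ideal.Quotient.mk (Ideal.span {R}) B := by
      rw [← hb, ← h2, Units.val_mul, ← ha]
      nth_rewrite 1 [← h1]
      ring
    rw [← map_prod, ← map_mul, ← map_mul, mk_eq_mk_iff, ← mul_sub] at h3
    exact h3
  have hD0 : ∏ P ∈ bad, P.1 ≠ 0 := Finset.prod_ne_zero_iff.2 fun P _ => (hP P).1.2.ne_zero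
  have hle : absV R ≤ (∏ P ∈ bad, absV P.1) * absV (A - B) := by
    rw [← absV_prod, ← absV_mul]
    exact absV_le_of_dvd hdvd (mul_ne_zero hD0 (sub_ne_zero.2 hAB))
  have hprodpos : 0 < ∏ P ∈ bad, absV P.1 :=
    Finset.prod_pos fun P _ => absV_pos (hP P).1.2.ne_zero
  calc (∏ P, if x P = 1 then (1 : ℝ) else ((Nat.card (unitsFixing
          (Ideal.Quotient.mk (Ideal.span {R}) P.1)) : ℝ) - 1)⁻¹)
      = ∏ P ∈ bad, ((Nat.card (unitsFixing
          (Ideal.Quotient.mk (Ideal.span {R}) P.1)) : ℝ) - 1)⁻¹ := by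
        rw [hbad, Finset.prod_filter]
        refine Finset.prod_congr rfl fun P _ => ?_
        by_cases h : x P = 1 <;> simp [h]
    _ ≤ ∏ P ∈ bad, ((if P.1.natDegree = 1 then (Fintype.card F : ℝ) ^ (1 / 4 : ℝ) else 1) *
          (absV P.1 ^ (1 / 4 : ℝ))⁻¹) := by
        refine Finset.prod_le_prod (fun P _ => ?_) fun P hPb => ?_
        · rw [inv_nonneg, sub_nonneg]
          exact_mod_cast card_unitsFixing_pos _
        · exact inv_card_unitsFixing_sub_one_le (hP P).1.1 (hP P).1.2 hR (hP P).2 (hx P)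
            (Finset.mem_filter.1 hPb).2
    _ = (∏ P ∈ bad, if P.1.natDegree = 1 then (Fintype.card F : ℝ) ^ (1 / 4 : ℝ) else 1) *
          ((∏ P ∈ bad, absV P.1) ^ (1 / 4 : ℝ))⁻¹ := by
        rw [Finset.prod_mul_distrib, Finset.prod_inv_distrib,
          Real.finsetProd_rpow _ _ fun P _ => (absV_pos (hP P).1.2.ne_zero).le]
    _ ≤ _ := by
        refine mul_le_mul ?_ ?_ (by positivity) hCpos.le
        · rw [← Finset.prod_filter, Finset.prod_const, linearPrimesFactor]
          refine pow_le_pow_right₀ (Real.one_le_rpow (by linarith) (by norm_num)) ?_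
          refine Finset.card_le_card_of_injOn Subtype.val (fun P hPb => ?_)
            Subtype.val_injective.injOn
          rw [Finset.mem_coe, Finset.mem_filter] at hPb
          exact mem_primesLE.2 ⟨(hP P).1, hPb.2.le⟩
        · rw [← Real.inv_rpow hprodpos.le]
          refine Real.rpow_le_rpow (by positivity) ?_ (by norm_num)
          rw [inv_le_comm₀ hprodpos (div_pos (absV_pos (sub_ne_zero.2 hAB))
            (absV_pos hR.ne_zero)), inv_div, div_le_iff₀ (absV_pos (sub_ne_zero.2 hAB))]
          exact hle

/-! ### Counting primes and prime powers -/

/-- The polynomial `T^(q^n) - T` is squarefree, its monic irreducible factors are exactly the primes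
of degree dividing `n`, and its degree is `q^n`. -/
theorem sum_natDegree_primes_dvd {n X : ℕ} (hn : 0 < n) (hX : n ≤ X) :
    ∑ P ∈ primesLE F X, (if P.natDegree ∣ n then P.natDegree else 0) = Fintype.card F ^ n := by
  classical
  have hq : 1 < Fintype.card F := Fintype.one_lt_card
  have hpow : 1 < Fintype.card F ^ n := Nat.one_lt_pow hn.ne' hq
  set f : F[X] := Polynomial.X ^ Fintype.card F ^ n - Polynomial.X with hf
  have hdeg : f.natDegree = Fintype.card F ^ n := by
    exact FiniteField.X_pow_card_pow_sub_X_natDegree_eq F hn.ne' hq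
  have hf0 : f ≠ 0 := by
    intro h
    rw [h, natDegree_zero] at hdeg
    omega
  have hsq : Squarefree f := by
    refine Separable.squarefree ?_
    obtain ⟨p, hp⟩ := CharP.exists F
    refine galois_poly_separable p _ ?_
    obtain ⟨m, hp', hm⟩ := FiniteField.card F p
    rw [hm]
    exact dvd_pow (dvd_pow_self p m.2.ne') hn.ne'
  have hnd := (UniqueFactorizationMonoid.squarefree_iff_nodup_normalizedFactors hf0).1 hsq
  have hset : (primesLE F X).filter (fun P => P.natDegree ∣ n) =
      (UniqueFactorizationMonoid.normalizedFactors f).toFinset := by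
    ext P
    rw [Finset.mem_filter, mem_primesLE, Multiset.mem_toFinset,
      UniqueFactorizationMonoid.mem_normalizedFactors_iff' hf0]
    constructor
    · rintro ⟨⟨⟨h1, h2⟩, -⟩, h3⟩
      refine ⟨h2, h1.normalize_eq_self, ?_⟩
      have := (Irreducible.natDegree_dvd_iff_dvd_X_pow_card_pow_sub_X h2).1 h3
      rwa [Nat.card_eq_fintype_card] at this
    · rintro ⟨h2, h1, h3⟩
      have hdvd : P.natDegree ∣ n := by
        refine (Irreducible.natDegree_dvd_iff_dvd_X_pow_card_pow_sub_X h2).2 ?_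
        rwa [Nat.card_eq_fintype_card]
      refine ⟨⟨⟨?_, h2⟩, (Nat.le_of_dvd hn hdvd).trans hX⟩, hdvd⟩
      rw [← h1]
      exact monic_normalize h2.ne_zero
  rw [← Finset.sum_filter, hset]
  have hprod : ∏ P ∈ (UniqueFactorizationMonoid.normalizedFactors f).toFinset, P =
      (UniqueFactorizationMonoid.normalizedFactors f).prod := by
    rw [Finset.prod_multiset_count]
    exact Finset.prod_congr rfl fun P hP => by
      rw [Multiset.count_eq_one_of_mem hnd (Multiset.mem_toFinset.1 hP), pow_one]
  rw [← natDegree_prod, hprod, ← hdeg]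
  · exact natDegree_eq_of_degree_eq
      (degree_eq_degree_of_associated (UniqueFactorizationMonoid.prod_normalizedFactors hf0))
  · intro P hP
    rw [Multiset.mem_toFinset] at hP
    exact (UniqueFactorizationMonoid.irreducible_of_normalized_factor P hP).ne_zero

theorem sum_range_dvd {d : ℕ} (hd : 0 < d) (X : ℕ) (h : ℕ → ℝ) :
    ∑ n ∈ Finset.range X, (if d ∣ n + 1 then h (n + 1) else 0) =
      ∑ j ∈ Finset.range (X / d), h ((j + 1) * d) := by
  rw [← Finset.sum_filter]
  symm
  refine Finset.sum_bij (fun j _ => (j + 1) * d - 1) ?_ ?_ ?_ ?_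
  · intro j hj
    have h1 : j + 1 ≤ X / d := Finset.mem_range.1 hj
    have h2 := (Nat.le_div_iff_mul_le hd).1 h1
    have h3 : 0 < (j + 1) * d := by positivity
    rw [Finset.mem_filter, Finset.mem_range, Nat.sub_add_cancel h3]
    exact ⟨by omega, dvd_mul_left _ _⟩
  · intro j _ j' _ h
    have h3 : 0 < (j + 1) * d := by positivity
    have h4 : 0 < (j' + 1) * d := by positivity
    have : (j + 1) * d = (j' + 1) * d := by omega
    have := Nat.eq_of_mul_eq_mul_right hd this
    omega
  · intro n hn
    rw [Finset.mem_filter, Finset.mem_range] at hn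
    obtain ⟨hn, c, hc⟩ := hn
    have hc0 : 0 < c := Nat.pos_of_ne_zero (by rintro rfl; simp at hc)
    refine ⟨c - 1, ?_, ?_⟩
    · rw [Finset.mem_range]
      have : c ≤ X / d := (Nat.le_div_iff_mul_le hd).2 (by rw [mul_comm]; omega)
      omega
    · rw [Nat.sub_add_cancel hc0, mul_comm]; omega
  · intro j _
    have h3 : 0 < (j + 1) * d := by positivity
    rw [Nat.sub_add_cancel h3]

/-- Summation over prime powers of degree at most `X`: there are `q ^ n / n` prime powers of
degree `n`, each `P ^ j` being counted with weight `1 / j`. -/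
theorem sum_primes_sum_powers (X : ℕ) (g : ℕ → ℝ) :
    ∑ P ∈ primesLE F X, ∑ j ∈ Finset.range (X / P.natDegree),
        g ((j + 1) * P.natDegree) / (j + 1) =
      ∑ n ∈ Finset.range X, g (n + 1) * (Fintype.card F : ℝ) ^ (n + 1) / (n + 1) := by
  have h1 : ∀ n ∈ Finset.range X, g (n + 1) * (Fintype.card F : ℝ) ^ (n + 1) / (n + 1) =
      ∑ P ∈ primesLE F X, if P.natDegree ∣ n + 1 then
        g (n + 1) * P.natDegree / ((n + 1 : ℕ) : ℝ) else 0 := by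
    intro n hn
    have h := sum_natDegree_primes_dvd (F := F) (Nat.succ_pos n) (Finset.mem_range.1 hn)
    rw [← Nat.cast_pow, ← h, Nat.cast_sum, Finset.mul_sum, Finset.sum_div]
    refine Finset.sum_congr rfl fun P _ => ?_
    push_cast
    split_ifs <;> simp
  rw [Finset.sum_congr rfl h1, Finset.sum_comm]
  refine Finset.sum_congr rfl fun P hP => ?_
  have hd := (mem_primesLE.1 hP).1.2.natDegree_pos
  rw [sum_range_dvd hd X fun n => g n * P.natDegree / (n : ℝ)]
  refine Finset.sum_congr rfl fun j _ => ?_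
  have : (P.natDegree : ℝ) ≠ 0 := by exact_mod_cast hd.ne'
  have : (j : ℝ) + 1 ≠ 0 := by positivity
  push_cast
  field_simp

/-! ### The partial Euler product and the divisor function at prime powers -/

omit [Fintype F] in
theorem prime_pow_injective {P Q : F[X]} (hP : P.Monic ∧ Irreducible P)
    (hQ : Q.Monic ∧ Irreducible Q) {i j : ℕ} (hi : i ≠ 0) (h : P ^ i = Q ^ j) :
    P = Q ∧ i = j := by
  have h1 : P ∣ Q := hP.2.prime.dvd_of_dvd_pow (h ▸ dvd_pow_self P hi)
  have h2 := eq_of_dvd_of_monic hP.1 hQ.1 hP.2 hQ.2 h1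
  refine ⟨h2, ?_⟩
  subst h2
  have h3 := congrArg natDegree h
  rw [natDegree_pow, natDegree_pow] at h3
  exact Nat.eq_of_mul_eq_mul_right hP.2.natDegree_pos h3

theorem vonMangoldt_prime_pow {P : F[X]} (hP : P.Monic ∧ Irreducible P) (j : ℕ) :
    vonMangoldt (P ^ (j + 1)) = Real.log (absV P) := by
  have h : ∃ Q : F[X], (Q.Monic ∧ Irreducible Q) ∧ ∃ i : ℕ, 0 < i ∧ P ^ (j + 1) = Q ^ i :=
    ⟨P, hP, j + 1, Nat.succ_pos j, rfl⟩
  rw [vonMangoldt, dif_pos h]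
  obtain ⟨i, hi, he⟩ := h.choose_spec.2
  rw [← (prime_pow_injective hP h.choose_spec.1 (Nat.succ_ne_zero j) he).1]

/-- Only prime powers `A = P^(j+1)` contribute, and there `Λ(A) / log |A| = 1 / (j + 1)`. -/
theorem partialEulerProduct_eq (X : ℕ) {R : F[X]} (χ : DirichletChar R) :
    partialEulerProduct X (1 / 2) χ = Complex.exp (∑ P ∈ primesLE F X,
      ∑ j ∈ Finset.range (X / P.natDegree),
        (χ.eval P * ((absV P ^ (-(1 / 2) : ℝ) : ℝ) : ℂ)) ^ (j + 1) / (j + 1)) := by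
  rw [partialEulerProduct]
  congr 1
  rw [Finset.sum_sigma']
  symm
  refine Finset.sum_of_injOn (fun x => x.1 ^ (x.2 + 1)) ?_ ?_ ?_ ?_
  · rintro ⟨P, i⟩ hx ⟨Q, j⟩ hy h
    rw [Finset.mem_coe, Finset.mem_sigma] at hx hy
    obtain ⟨h1, h2⟩ := prime_pow_injective (mem_primesLE.1 hx.1).1 (mem_primesLE.1 hy.1).1
      (Nat.succ_ne_zero i) h
    dsimp only at h1 h2
    rw [h1, Nat.succ_injective h2]
  · rintro ⟨P, i⟩ hx
    rw [Finset.mem_coe, Finset.mem_sigma] at hx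
    obtain ⟨⟨hP, hPi⟩, -⟩ := mem_primesLE.1 hx.1
    refine mem_monicsLE.2 ⟨hP.pow _, ?_⟩
    rw [natDegree_pow]
    exact (Nat.le_div_iff_mul_le hPi.natDegree_pos).1 (Finset.mem_range.1 hx.2)
  · intro A hA h
    suffices h0 : vonMangoldt A = 0 by rw [h0]; simp
    refine dif_neg ?_
    rintro ⟨P, hP, j, hj, rfl⟩
    refine h ⟨⟨P, j - 1⟩, ?_, ?_⟩
    · rw [mem_monicsLE, natDegree_pow] at hA
      rw [Finset.mem_coe, Finset.mem_sigma]
      have h1 : P.natDegree ≤ X := (Nat.le_mul_of_pos_left _ hj).trans hA.2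
      refine ⟨mem_primesLE.2 ⟨hP, h1⟩, Finset.mem_range.2 ?_⟩
      have := (Nat.le_div_iff_mul_le hP.2.natDegree_pos).2 hA.2
      dsimp only
      omega
    · simp only [Nat.sub_add_cancel hj]
  · rintro ⟨P, j⟩ hx
    rw [Finset.mem_sigma] at hx
    obtain ⟨hP, -⟩ := mem_primesLE.1 hx.1
    have hpos := absV_pos hP.2.ne_zero
    have hlog : Real.log (absV P) ≠ 0 := (Real.log_pos (by linarith [two_le_absV hP.2])).ne'
    dsimp only
    rw [vonMangoldt_prime_pow hP, DirichletChar.eval_pow, absV_pow, Real.log_pow]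
    have h1 : (((absV P ^ (j + 1) : ℝ)) : ℂ) ^ (1 / 2 : ℂ) =
        ((absV P ^ (1 / 2 : ℝ) : ℝ) : ℂ) ^ (j + 1) := by
      have : (1 / 2 : ℂ) = ((1 / 2 : ℝ) : ℂ) := by push_cast; rfl
      rw [this, ← Complex.ofReal_cpow (by positivity), ← Complex.ofReal_pow,
        ← Real.rpow_natCast, ← Real.rpow_natCast, ← Real.rpow_mul hpos.le, ← Real.rpow_mul hpos.le,
        mul_comm]
    rw [h1, Real.rpow_neg hpos.le, mul_pow, Complex.ofReal_inv, inv_pow]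
    have h2 : ((absV P ^ (1 / 2 : ℝ) : ℝ) : ℂ) ≠ 0 := by
      exact_mod_cast (Real.rpow_pos_of_pos hpos _).ne'
    have h3 : ((Real.log (absV P) : ℝ) : ℂ) ≠ 0 := by exact_mod_cast hlog
    have h4 : (j : ℂ) + 1 ≠ 0 := by exact_mod_cast Nat.succ_ne_zero j
    push_cast
    field_simp

-- By unique factorization the monic factors are powers of `P`, so one counts tuples of exponents
-- with sum `m` (stars and bars).
omit [Fintype F] in
theorem divisorFn_prime_pow (k : ℕ) {P : F[X]} (hP : P.Monic ∧ Irreducible P) (m : ℕ) :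
    divisorFn k (P ^ m) = k.multichoose m := by
  classical
  have hinj : Function.Injective fun n : ℕ => P ^ n := fun i j h => by
    have h3 := congrArg natDegree h
    simp only [natDegree_pow] at h3
    exact Nat.eq_of_mul_eq_mul_right hP.2.natDegree_pos h3
  have himage : {f : Fin k → F[X] | (∀ i, (f i).Monic) ∧ ∏ i, f i = P ^ m} =
      (fun e : Fin k →₀ ℕ => fun i => P ^ e i) ''
        (Finset.finsuppAntidiag (Finset.univ : Finset (Fin k)) m : Set (Fin k →₀ ℕ)) := by
    ext f
    simp only [Set.mem_ofPred_eq, Set.mem_image, Finset.mem_coe, Finset.mem_finsuppAntidiag]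
    constructor
    · rintro ⟨hf, hprod⟩
      have h1 : ∀ i, ∃ e, f i = P ^ e := by
        intro i
        have h2 : f i ∣ P ^ m := hprod ▸ Finset.dvd_prod_of_mem f (Finset.mem_univ i)
        obtain ⟨e, -, he⟩ := (dvd_prime_pow hP.2.prime m).1 h2
        exact ⟨e, eq_of_monic_of_associated (hf i) (hP.1.pow e) he⟩
      choose e he using h1
      refine ⟨Finsupp.equivFunOnFinite.symm e, ⟨?_, Finset.subset_univ _⟩, ?_⟩
      · apply hinj
        dsimp only
        rw [← hprod, ← Finset.prod_pow_eq_pow_sum]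
        exact Finset.prod_congr rfl fun i _ => (he i).symm
      · funext i
        exact (he i).symm
    · rintro ⟨e, ⟨he, -⟩, rfl⟩
      refine ⟨fun i => hP.1.pow _, ?_⟩
      rw [Finset.prod_pow_eq_pow_sum, he]
  rw [divisorFn, himage, Set.ncard_image_of_injective, Set.ncard_coe_finset,
    Finset.card_finsuppAntidiag_nat_eq_multichoose, Finset.card_univ, Fintype.card_fin]
  intro e e' h
  ext i
  exact hinj (congrFun h i)

/-! ### Expansion over smooth polynomials coprime to `R` -/

open Classical in
/-- The primes of degree at most `X` not dividing `R`. -/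
def coprimePrimesLE (X : ℕ) (R : F[X]) : Finset F[X] := (primesLE F X).filter (¬ · ∣ R)

theorem mem_coprimePrimesLE {X : ℕ} {R P : F[X]} :
    P ∈ coprimePrimesLE X R ↔ P ∈ primesLE F X ∧ ¬ P ∣ R := by
  simp only [coprimePrimesLE, Finset.mem_filter]

/-- The smooth polynomial with prescribed exponents. -/
def smoothPoly {X : ℕ} {R : F[X]} (m : {P // P ∈ coprimePrimesLE X R} → ℕ) : F[X] :=
  ∏ P, P.1 ^ m P

theorem smoothPoly_injective {X : ℕ} {R : F[X]} :
    Function.Injective (smoothPoly : ({P // P ∈ coprimePrimesLE X R} → ℕ) → F[X]) := by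
  have hP : ∀ P : {P // P ∈ coprimePrimesLE X R}, P.1.Monic ∧ Irreducible P.1 :=
    fun P => (mem_primesLE.1 (mem_coprimePrimesLE.1 P.2).1).1
  have key : ∀ (m : {P // P ∈ coprimePrimesLE X R} → ℕ) (P : {P // P ∈ coprimePrimesLE X R}),
      emultiplicity P.1 (smoothPoly m) = m P := by
    intro m P
    rw [smoothPoly, Finset.emultiplicity_prod (hP P).2.prime, Finset.sum_eq_single P]
    · exact emultiplicity_pow_self_of_prime (hP P).2.prime _
    · intro Q _ hQ
      refine emultiplicity_eq_zero.2 fun h => hQ ?_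
      exact Subtype.ext (eq_of_dvd_of_monic (hP P).1 (hP Q).1 (hP P).2 (hP Q).2
        ((hP P).2.prime.dvd_of_dvd_pow h)).symm
    · exact fun h => absurd (Finset.mem_univ _) h
  intro m m' h
  funext P
  have := key m P
  rw [h, key m' P] at this
  exact_mod_cast this.symm

theorem smoothPoly_isCoprime {X : ℕ} {R : F[X]} (m : {P // P ∈ coprimePrimesLE X R} → ℕ) :
    IsCoprime (smoothPoly m) R := by
  refine IsCoprime.prod_left fun P _ => IsCoprime.pow_left ?_
  obtain ⟨h1, h2⟩ := mem_coprimePrimesLE.1 P.2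
  exact (mem_primesLE.1 h1).1.2.coprime_iff_not_dvd.2 h2

theorem smoothPoly_ne_zero {X : ℕ} {R : F[X]} (m : {P // P ∈ coprimePrimesLE X R} → ℕ) :
    smoothPoly m ≠ 0 :=
  Finset.prod_ne_zero_iff.2 fun P _ =>
    pow_ne_zero _ (mem_primesLE.1 (mem_coprimePrimesLE.1 P.2).1).1.2.ne_zero

/-- The coefficient of `χ (smoothPoly m)` in the expansion of `P_X(1/2, χ) ^ k`. -/
def smoothCoeff (k : ℕ) {X : ℕ} {R : F[X]} (m : {P // P ∈ coprimePrimesLE X R} → ℕ) : ℝ :=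
  ∏ P, expCoeff k (X / P.1.natDegree) (m P) * (absV P.1 ^ (-(1 / 2) : ℝ)) ^ m P

theorem smoothCoeff_nonneg (k : ℕ) {X : ℕ} {R : F[X]}
    (m : {P // P ∈ coprimePrimesLE X R} → ℕ) : 0 ≤ smoothCoeff k m := by
  refine Finset.prod_nonneg fun P _ => mul_nonneg (expCoeff_nonneg _ _ _) (pow_nonneg ?_ _)
  exact Real.rpow_nonneg
    (absV_pos (mem_primesLE.1 (mem_coprimePrimesLE.1 P.2).1).1.2.ne_zero).le _

theorem absV_prime_pos {X : ℕ} {R : F[X]} (P : {P // P ∈ coprimePrimesLE X R}) :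
    0 < absV P.1 :=
  absV_pos (mem_primesLE.1 (mem_coprimePrimesLE.1 P.2).1).1.2.ne_zero

theorem hasSum_smoothCoeff_mul_eval (k X : ℕ) {R : F[X]} (χ : DirichletChar R) :
    HasSum (fun m : {P // P ∈ coprimePrimesLE X R} → ℕ =>
      (smoothCoeff k m : ℂ) * χ.eval (smoothPoly m)) (partialEulerProduct X (1 / 2) χ ^ k) := by
  classical
  set z : F[X] → ℂ := fun P => χ.eval P * ((absV P ^ (-(1 / 2) : ℝ) : ℝ) : ℂ) with hz
  have h1 : partialEulerProduct X (1 / 2) χ ^ k = ∏ P : {P // P ∈ coprimePrimesLE X R},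
      Complex.exp (k * ∑ j ∈ Finset.range (X / P.1.natDegree), z P.1 ^ (j + 1) / (j + 1)) := by
    rw [partialEulerProduct_eq, ← Complex.exp_nat_mul, Finset.mul_sum, Complex.exp_sum,
      Finset.prod_coe_sort (coprimePrimesLE X R) (fun P =>
        Complex.exp (k * ∑ j ∈ Finset.range (X / P.natDegree), z P ^ (j + 1) / (j + 1)))]
    symm
    -- Primes dividing `R` have `χ(P) = 0`, so their local factor is `exp 0 = 1`.
    refine Finset.prod_subset (fun P hP => (mem_coprimePrimesLE.1 hP).1) fun P hP hPR => ?_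
    have hdvd : P ∣ R := by
      by_contra h
      exact hPR (mem_coprimePrimesLE.2 ⟨hP, h⟩)
    have hzero : χ.eval P = 0 := by
      refine χ.eval_eq_zero fun h => ?_
      exact ((mem_primesLE.1 hP).1.2.coprime_iff_not_dvd.1 h) hdvd
    simp [hz, hzero]
  have h2 := fun P : {P // P ∈ coprimePrimesLE X R} =>
    hasSum_expCoeff k (X / P.1.natDegree) (z P.1)
  have h3 := (hasSum_pi_prod (fun (P : {P // P ∈ coprimePrimesLE X R}) n =>
    (expCoeff k (X / P.1.natDegree) n : ℂ) * z P.1 ^ n) fun P => by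
      refine (hasSum_expCoeff_real k (X / P.1.natDegree) ‖z P.1‖).summable.congr fun n => ?_
      rw [norm_mul (expCoeff k _ n : ℂ), norm_pow, Complex.norm_real, Real.norm_of_nonneg (expCoeff_nonneg _ _ _)]).2
  rw [h1, ← Finset.prod_congr rfl fun P _ => (h2 P).tsum_eq]
  refine h3.congr_fun fun m => ?_
  rw [smoothCoeff, smoothPoly, DirichletChar.eval_prod, Complex.ofReal_prod,
    ← Finset.prod_mul_distrib]
  refine Finset.prod_congr rfl fun P _ => ?_
  rw [hz, DirichletChar.eval_pow, mul_pow]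
  push_cast
  ring

/-- Used at `t = 0` for absolute convergence of the expansion and at `t = 1/4` for the cost of the
off-diagonal weight. -/
theorem hasSum_smoothCoeff_mul_rpow (k X : ℕ) (R : F[X]) (t : ℝ) :
    HasSum (fun m : {P // P ∈ coprimePrimesLE X R} → ℕ =>
      smoothCoeff k m * absV (smoothPoly m) ^ t)
      (∏ P : {P // P ∈ coprimePrimesLE X R}, Real.exp (k * ∑ j ∈ Finset.range (X / P.1.natDegree),
        (absV P.1 ^ (t - 1 / 2)) ^ (j + 1) / (j + 1))) := by
  have h2 := fun P : {P // P ∈ coprimePrimesLE X R} =>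
    hasSum_expCoeff_real k (X / P.1.natDegree) (absV P.1 ^ (t - 1 / 2))
  have h3 := hasSum_pi_prod_real (fun (P : {P // P ∈ coprimePrimesLE X R}) n =>
    expCoeff k (X / P.1.natDegree) n * (absV P.1 ^ (t - 1 / 2)) ^ n) fun P => (h2 P).summable
  rw [← Finset.prod_congr rfl fun P _ => (h2 P).tsum_eq]
  refine h3.congr_fun fun m => ?_
  rw [smoothCoeff, smoothPoly, absV_prod, ← Real.finsetProd_rpow, ← Finset.prod_mul_distrib]
  · refine Finset.prod_congr rfl fun P _ => ?_
    have hpos := absV_prime_pos P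
    rw [absV_pow, sub_eq_add_neg, Real.rpow_add hpos, mul_pow, ← Real.rpow_natCast (_ ^ t),
      ← Real.rpow_mul hpos.le, ← Real.rpow_natCast (absV P.1), ← Real.rpow_mul hpos.le,
      mul_comm t]
    ring
  · intro P _
    rw [absV_pow]
    exact pow_nonneg (absV_prime_pos P).le _

/-! ### Diagonal and off-diagonal contributions to the moment -/

/-- The diagonal contribution to the moment. -/
def diagonalTerm (k X : ℕ) (R : F[X]) : ℝ :=
  ∏ P ∈ coprimePrimesLE X R,
    ∑' n, expCoeff k (X / P.natDegree) n ^ 2 / absV P ^ n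

/-- The squares are the diagonal of the product of the series at `√x` with itself. -/
theorem summable_expCoeff_sq (k J : ℕ) {x : ℝ} (hx : 0 ≤ x) :
    Summable fun n => expCoeff k J n ^ 2 * x ^ n := by
  have h := (hasSum_expCoeff_real k J (Real.sqrt x)).summable
  have h0 : ∀ n, 0 ≤ expCoeff k J n * Real.sqrt x ^ n := fun n =>
    mul_nonneg (expCoeff_nonneg _ _ _) (pow_nonneg (Real.sqrt_nonneg _) _)
  have := (h.mul_of_nonneg h h0 h0).comp_injective (i := fun n : ℕ => (n, n))
    fun a b h => (Prod.ext_iff.1 h).1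
  refine this.congr fun n => ?_
  simp only [Function.comp]
  rw [← sq, mul_pow, ← pow_mul, mul_comm n 2, pow_mul, Real.sq_sqrt hx]

theorem tsum_smoothCoeff_sq (k X : ℕ) (R : F[X]) :
    ∑' m : {P // P ∈ coprimePrimesLE X R} → ℕ, smoothCoeff k m ^ 2 = diagonalTerm k X R := by
  have h3 := hasSum_pi_prod_real (fun (P : {P // P ∈ coprimePrimesLE X R}) n =>
    expCoeff k (X / P.1.natDegree) n ^ 2 / absV P.1 ^ n) fun P => by
      refine (summable_expCoeff_sq k (X / P.1.natDegree)
        (inv_nonneg.2 (absV_prime_pos P).le)).congr fun n => ?_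
      rw [inv_pow, div_eq_mul_inv]
  rw [diagonalTerm, ← Finset.prod_coe_sort, ← h3.tsum_eq]
  refine tsum_congr fun m => ?_
  rw [smoothCoeff, ← Finset.prod_pow]
  refine Finset.prod_congr rfl fun P _ => ?_
  have hpos := absV_prime_pos P
  have h1 : (absV P.1 ^ (-(1 / 2) : ℝ)) ^ 2 = (absV P.1)⁻¹ := by
    rw [← Real.rpow_natCast, ← Real.rpow_mul hpos.le, ← Real.rpow_neg_one]
    norm_num
  rw [mul_pow, ← pow_mul, mul_comm (m P) 2, pow_mul, h1, inv_pow, div_eq_mul_inv]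

/-- After extending the exponent to all primes of degree at most `X`, the exact count of prime
powers gives `∑ q^(3n/4) / n` over `n ≤ X`, and each term is at most `q^(3X/4)`. -/
theorem prod_exp_le (k X : ℕ) (R : F[X]) :
    ∏ P : {P // P ∈ coprimePrimesLE X R}, Real.exp (k * ∑ j ∈ Finset.range (X / P.1.natDegree),
        (absV P.1 ^ (1 / 4 - 1 / 2 : ℝ)) ^ (j + 1) / (j + 1)) ≤
      Real.exp (k * (X * ((Fintype.card F : ℝ) ^ X) ^ (3 / 4 : ℝ))) := by
  have hq := two_le_card (F := F)
  have hq0 : (0 : ℝ) < Fintype.card F := by linarith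
  rw [← Real.exp_sum, ← Finset.mul_sum]
  refine Real.exp_le_exp.2 (mul_le_mul_of_nonneg_left ?_ (Nat.cast_nonneg k))
  rw [Finset.sum_coe_sort (coprimePrimesLE X R) (fun P =>
    ∑ j ∈ Finset.range (X / P.natDegree), (absV P ^ (1 / 4 - 1 / 2 : ℝ)) ^ (j + 1) / (j + 1))]
  calc ∑ P ∈ coprimePrimesLE X R, ∑ j ∈ Finset.range (X / P.natDegree),
        (absV P ^ (1 / 4 - 1 / 2 : ℝ)) ^ (j + 1) / (j + 1)
      ≤ ∑ P ∈ primesLE F X, ∑ j ∈ Finset.range (X / P.natDegree),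
        (absV P ^ (1 / 4 - 1 / 2 : ℝ)) ^ (j + 1) / (j + 1) := by
        refine Finset.sum_le_sum_of_subset_of_nonneg (fun P hP => (mem_coprimePrimesLE.1 hP).1)
          fun P hP _ => Finset.sum_nonneg fun j _ => ?_
        have := absV_pos (mem_primesLE.1 hP).1.2.ne_zero
        positivity
    _ = ∑ P ∈ primesLE F X, ∑ j ∈ Finset.range (X / P.natDegree),
        (fun n : ℕ => ((Fintype.card F : ℝ) ^ n) ^ (1 / 4 - 1 / 2 : ℝ))
          ((j + 1) * P.natDegree) / (j + 1) := by
        refine Finset.sum_congr rfl fun P hP => Finset.sum_congr rfl fun j _ => ?_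
        have hpos : (0 : ℝ) ≤ (Fintype.card F : ℝ) ^ P.natDegree := by positivity
        dsimp only
        rw [absV_eq (mem_primesLE.1 hP).1.2.ne_zero, mul_comm (j + 1), pow_mul,
          ← Real.rpow_natCast (_ ^ _), ← Real.rpow_natCast (_ ^ P.natDegree) (j + 1),
          ← Real.rpow_mul hpos, ← Real.rpow_mul hpos, mul_comm]
    _ = ∑ n ∈ Finset.range X, ((Fintype.card F : ℝ) ^ (n + 1)) ^ (1 / 4 - 1 / 2 : ℝ) *
          (Fintype.card F : ℝ) ^ (n + 1) / (n + 1) :=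
        sum_primes_sum_powers X fun n : ℕ => ((Fintype.card F : ℝ) ^ n) ^ (1 / 4 - 1 / 2 : ℝ)
    _ ≤ ∑ _n ∈ Finset.range X, ((Fintype.card F : ℝ) ^ X) ^ (3 / 4 : ℝ) := by
        refine Finset.sum_le_sum fun n hn => ?_
        have hpos : (0 : ℝ) < (Fintype.card F : ℝ) ^ (n + 1) := by positivity
        have h1 : ((Fintype.card F : ℝ) ^ (n + 1)) ^ (1 / 4 - 1 / 2 : ℝ) *
            (Fintype.card F : ℝ) ^ (n + 1) = ((Fintype.card F : ℝ) ^ (n + 1)) ^ (3 / 4 : ℝ) := by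
          nth_rewrite 2 [← Real.rpow_one ((Fintype.card F : ℝ) ^ (n + 1))]
          rw [← Real.rpow_add hpos]
          norm_num
        rw [h1]
        refine (div_le_self (by positivity) (by linarith [(n.cast_nonneg : (0 : ℝ) ≤ n)])).trans ?_
        exact Real.rpow_le_rpow hpos.le
          (pow_le_pow_right₀ (by linarith) (Finset.mem_range.1 hn)) (by norm_num)
    _ = _ := by rw [Finset.sum_const, Finset.card_range, nsmul_eq_mul]

theorem abs_eulerMoment_sub_diagonalTerm_le (k X : ℕ) (R : MonicPoly F)
    (hne : (primitiveChars R).Nonempty) :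
    |eulerMoment k X R - diagonalTerm k X R.1| ≤
      linearPrimesFactor F * (absV R.1 ^ (1 / 4 : ℝ))⁻¹ *
        Real.exp (k * (X * ((Fintype.card F : ℝ) ^ X) ^ (3 / 4 : ℝ))) ^ 2 := by
  have hR0 := absV_pos R.2.ne_zero
  have hC := linearPrimesFactor_pos (F := F)
  have hcard : (0 : ℝ) < (primitiveChars R).card := by exact_mod_cast Finset.card_pos.2 hne
  have h0 := hasSum_smoothCoeff_mul_rpow k X R.1 0
  have h14 := hasSum_smoothCoeff_mul_rpow k X R.1 (1 / 4)
  have main := abs_sum_normSq_sub_le (primitiveChars R)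
    (fun m : {P // P ∈ coprimePrimesLE X R.1} → ℕ => smoothCoeff k m)
    (fun m => absV (smoothPoly m) ^ (1 / 4 : ℝ)) (fun χ m => χ.eval (smoothPoly m))
    (fun χ => partialEulerProduct X (1 / 2) χ ^ k)
    (ε := linearPrimesFactor F * (absV R.1 ^ (1 / 4 : ℝ))⁻¹)
    (smoothCoeff_nonneg k) (by simpa using h0.summable) h14.summable
    (fun m => Real.rpow_nonneg (absV_pos (smoothPoly_ne_zero m)).le _) (by positivity)
    (fun χ _ m => χ.norm_eval R.2 (smoothPoly_isCoprime m))
    (fun χ _ => hasSum_smoothCoeff_mul_eval k X χ) ?_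
  · rw [tsum_smoothCoeff_sq, h14.tsum_eq] at main
    have hE : eulerMoment k X R - diagonalTerm k X R.1 = (1 / ((primitiveChars R).card : ℝ)) *
        (∑ χ ∈ primitiveChars R, ‖partialEulerProduct X (1 / 2) χ ^ k‖ ^ 2 -
          (primitiveChars R).card * diagonalTerm k X R.1) := by
      rw [eulerMoment, mul_sub, one_div, inv_mul_cancel_left₀ hcard.ne']
      congr 2
      refine Finset.sum_congr rfl fun χ _ => ?_
      rw [norm_pow, ← pow_mul, mul_comm]
    rw [hE, abs_mul, abs_of_pos (by positivity), one_div, inv_mul_le_iff₀ hcard]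
    refine main.trans (mul_le_mul_of_nonneg_left (mul_le_mul_of_nonneg_left ?_ (by positivity))
      hcard.le)
    exact pow_le_pow_left₀ (Finset.prod_nonneg fun P _ => (Real.exp_pos _).le)
      (prod_exp_le k X R.1) 2
  · intro m m' hmm
    have hne' : smoothPoly m ≠ smoothPoly m' := fun h => hmm (smoothPoly_injective h)
    refine (norm_sum_primitiveChars_le R (smoothPoly_isCoprime m) (smoothPoly_isCoprime m')
      hne').trans (mul_le_mul_of_nonneg_left ?_ hcard.le)
    have hm := absV_pos (smoothPoly_ne_zero m)
    have hm' := absV_pos (smoothPoly_ne_zero m')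
    rw [mul_assoc]
    refine mul_le_mul_of_nonneg_left ?_ hC.le
    rw [Real.div_rpow (absV_pos (sub_ne_zero.2 hne')).le hR0.le, div_eq_inv_mul,
      ← Real.mul_rpow hm.le hm'.le]
    refine mul_le_mul_of_nonneg_left ?_ (by positivity)
    exact Real.rpow_le_rpow (absV_pos (sub_ne_zero.2 hne')).le
      (absV_sub_le_mul (smoothPoly_ne_zero m) (smoothPoly_ne_zero m') hne') (by norm_num)

/-! ### The local series and sums over all primes -/

theorem multichoose_le_pow (k m : ℕ) : k.multichoose m ≤ (m + k) ^ k := by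
  rcases k with _ | k
  · cases m <;> simp
  · rw [Nat.multichoose_eq, show k + 1 + m - 1 = m + k by omega, Nat.choose_symm_add]
    calc (m + k).choose k ≤ (m + k) ^ k := Nat.choose_le_pow _ _
      _ ≤ (m + (k + 1)) ^ k := Nat.pow_le_pow_left (by omega) _
      _ ≤ (m + (k + 1)) ^ (k + 1) := Nat.pow_le_pow_right (by omega) (by omega)

theorem summable_multichoose_sq_mul_pow (k : ℕ) {r : ℝ} (h0 : 0 < r) (h1 : r < 1) :
    Summable fun m : ℕ => (k.multichoose m : ℝ) ^ 2 * r ^ m := by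
  have h := summable_pow_mul_geometric_of_norm_lt_one (R := ℝ) (k * 2) (r := r)
    (by rwa [Real.norm_of_nonneg h0.le])
  have h2 := ((summable_nat_add_iff k).2 h).mul_left (r ^ k)⁻¹
  refine h2.of_nonneg_of_le (fun m => by positivity) fun m => ?_
  have h3 : (k.multichoose m : ℝ) ≤ ((m + k : ℕ) : ℝ) ^ k := by
    exact_mod_cast multichoose_le_pow k m
  have h4 : (k.multichoose m : ℝ) ^ 2 ≤ ((m + k : ℕ) : ℝ) ^ (k * 2) := by
    rw [pow_mul]
    exact pow_le_pow_left₀ (Nat.cast_nonneg _) h3 2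
  calc (k.multichoose m : ℝ) ^ 2 * r ^ m ≤ ((m + k : ℕ) : ℝ) ^ (k * 2) * r ^ m := by gcongr
    _ = _ := by rw [pow_add]; field_simp

theorem one_le_multichoose {k : ℕ} (hk : 0 < k) (m : ℕ) : 1 ≤ k.multichoose m := by
  rw [Nat.multichoose_eq]
  exact Nat.choose_pos (by omega)

theorem localTerm_eq (k : ℕ) (P : PrimePoly F) (m : ℕ) :
    localTerm k P.1 m = (k.multichoose m : ℝ) ^ 2 * ((absV P.1)⁻¹) ^ m := by
  rw [localTerm, divisorFn_prime_pow k P.2, inv_pow, div_eq_mul_inv]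

theorem prime_inv_pos (P : PrimePoly F) : 0 < (absV P.1)⁻¹ :=
  inv_pos.2 (absV_pos P.2.2.ne_zero)

theorem prime_inv_le_half (P : PrimePoly F) : (absV P.1)⁻¹ ≤ 1 / 2 := by
  rw [one_div]
  exact inv_anti₀ (by norm_num) (two_le_absV P.2.2)

theorem localTerm_nonneg (k : ℕ) (P : PrimePoly F) (m : ℕ) : 0 ≤ localTerm k P.1 m := by
  have := prime_inv_pos P
  rw [localTerm_eq]
  positivity

theorem summable_localTerm (k : ℕ) (P : PrimePoly F) : Summable (localTerm k P.1) := by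
  have := summable_multichoose_sq_mul_pow k (prime_inv_pos P)
    ((prime_inv_le_half P).trans_lt (by norm_num))
  exact this.congr fun m => (localTerm_eq k P m).symm

/-- A constant bounding the quadratic tail of the local series. -/
def quadraticConst (k : ℕ) : ℝ := ∑' m : ℕ, (k.multichoose (m + 2) : ℝ) ^ 2 * (1 / 2) ^ m

theorem summable_quadraticConst (k : ℕ) :
    Summable fun m : ℕ => (k.multichoose (m + 2) : ℝ) ^ 2 * (1 / 2 : ℝ) ^ m := by
  have h := (summable_nat_add_iff 2).2
    (summable_multichoose_sq_mul_pow k (r := 1 / 2) (by norm_num) (by norm_num))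
  refine (h.mul_left 4).congr fun m => ?_
  rw [pow_add]; ring

theorem quadraticConst_nonneg (k : ℕ) : 0 ≤ quadraticConst k :=
  tsum_nonneg fun m => by positivity

theorem tsum_localTerm_add_two_le (k : ℕ) (P : PrimePoly F) :
    ∑' m, localTerm k P.1 (m + 2) ≤ quadraticConst k * ((absV P.1)⁻¹) ^ 2 := by
  rw [quadraticConst, ← tsum_mul_right]
  refine ((summable_nat_add_iff 2).2 (summable_localTerm k P)).tsum_le_tsum (fun m => ?_)
    ((summable_quadraticConst k).mul_right _)
  have h0 := prime_inv_pos P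
  have h1 := pow_le_pow_left₀ h0.le (prime_inv_le_half P) m
  rw [localTerm_eq, pow_add, ← mul_assoc]
  gcongr

theorem localSeries_eq (k : ℕ) (P : PrimePoly F) : localSeries k P.1 =
    1 + (k : ℝ) ^ 2 * (absV P.1)⁻¹ + ∑' m, localTerm k P.1 (m + 2) := by
  rw [localSeries, ← (summable_localTerm k P).sum_add_tsum_nat_add 2, Finset.sum_range_succ,
    Finset.sum_range_one, localTerm_eq, localTerm_eq]
  simp

theorem one_le_localSeries (k : ℕ) (P : PrimePoly F) : 1 ≤ localSeries k P.1 := by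
  rw [localSeries_eq]
  have h0 := prime_inv_pos P
  have h1 : 0 ≤ ∑' m, localTerm k P.1 (m + 2) := tsum_nonneg fun m => localTerm_nonneg k P _
  have : 0 ≤ (k : ℝ) ^ 2 * (absV P.1)⁻¹ := by positivity
  linarith

open Classical in
theorem sum_subtype_primesLE (X : ℕ) (f : F[X] → ℝ) :
    ∑ P ∈ (primesLE F X).subtype (fun P => P.Monic ∧ Irreducible P), f P.1 =
      ∑ P ∈ primesLE F X, f P :=
  Finset.sum_subtype_of_mem f fun _ hP => (mem_primesLE.1 hP).1

/-- Each `|P|^(-2)` is the `j = 0` term of a sum over powers of `P`, so the exact count of prime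
powers bounds every partial sum by `∑ q^(-n) / n`, a geometric tail. -/
theorem summable_prime_inv_sq : Summable fun P : PrimePoly F => ((absV P.1)⁻¹) ^ 2 := by
  classical
  have hq := two_le_card (F := F)
  have hq0 : (0 : ℝ) < Fintype.card F := by linarith
  refine summable_of_sum_le (c := 2) (fun P => by positivity) fun u => ?_
  obtain ⟨X, hX⟩ : ∃ X, ∀ P ∈ u, P.1.natDegree ≤ X :=
    ⟨u.sup fun P => P.1.natDegree, fun P hP => Finset.le_sup (f := fun P => P.1.natDegree) hP⟩
  calc ∑ P ∈ u, ((absV P.1)⁻¹) ^ 2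
      ≤ ∑ P ∈ (primesLE F X).subtype (fun P => P.Monic ∧ Irreducible P), ((absV P.1)⁻¹) ^ 2 := by
        refine Finset.sum_le_sum_of_subset_of_nonneg (fun P hP => ?_) fun P _ _ => by positivity
        exact Finset.mem_subtype.2 (mem_primesLE.2 ⟨P.2, hX P hP⟩)
    _ = ∑ P ∈ primesLE F X, ((absV P)⁻¹) ^ 2 := sum_subtype_primesLE X fun P => ((absV P)⁻¹) ^ 2
    _ ≤ ∑ P ∈ primesLE F X, ∑ j ∈ Finset.range (X / P.natDegree),
          (fun n : ℕ => ((Fintype.card F : ℝ)⁻¹ ^ 2) ^ n) ((j + 1) * P.natDegree) / (j + 1) := by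
        refine Finset.sum_le_sum fun P hP => ?_
        obtain ⟨⟨-, h1⟩, h2⟩ := mem_primesLE.1 hP
        have h3 : 0 ∈ Finset.range (X / P.natDegree) :=
          Finset.mem_range.2 (Nat.div_pos h2 h1.natDegree_pos)
        refine le_trans (le_of_eq ?_) (Finset.single_le_sum (fun j _ => ?_) h3)
        · rw [absV_eq h1.ne_zero]
          simp only [zero_add, one_mul, Nat.cast_zero, div_one]
          rw [← inv_pow, ← pow_mul, ← pow_mul, mul_comm]
        · positivity
    _ = ∑ n ∈ Finset.range X, ((Fintype.card F : ℝ)⁻¹ ^ 2) ^ (n + 1) *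
          (Fintype.card F : ℝ) ^ (n + 1) / (n + 1) :=
        sum_primes_sum_powers X fun n : ℕ => ((Fintype.card F : ℝ)⁻¹ ^ 2) ^ n
    _ ≤ ∑ n ∈ Finset.range X, (1 / 2 : ℝ) ^ n := by
        refine Finset.sum_le_sum fun n _ => ?_
        rw [← mul_pow]
        have h1 : (Fintype.card F : ℝ)⁻¹ ^ 2 * (Fintype.card F : ℝ) = (Fintype.card F : ℝ)⁻¹ := by
          field_simp
        rw [h1]
        have h2 : (Fintype.card F : ℝ)⁻¹ ≤ 1 / 2 := by
          rw [one_div]; exact inv_anti₀ (by norm_num) hq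
        refine (div_le_self (by positivity) (by linarith [(n.cast_nonneg : (0 : ℝ) ≤ n)])).trans ?_
        refine (pow_le_pow_left₀ (by positivity) h2 _).trans ?_
        exact pow_le_pow_of_le_one (by norm_num) (by norm_num) (Nat.le_succ n)
    _ ≤ 2 := by
        have := summable_geometric_two.sum_le_tsum (Finset.range X) fun n _ => by positivity
        rwa [tsum_geometric_two] at this

/-! ### Tails of the local series and comparison with the diagonal -/

/-- The part of the local series at `P` from the powers of degree larger than `X`, the first two
terms being left out. -/
def primeTail (k X : ℕ) (P : F[X]) : ℝ :=
  ∑' m, if X < (m + 2) * P.natDegree then localTerm k P (m + 2) else 0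

theorem summable_primeTail (k X : ℕ) (P : PrimePoly F) : Summable fun m =>
    if X < (m + 2) * P.1.natDegree then localTerm k P.1 (m + 2) else 0 := by
  refine ((summable_nat_add_iff 2).2 (summable_localTerm k P)).of_nonneg_of_le (fun m => ?_)
    fun m => ?_
  · split_ifs
    exacts [localTerm_nonneg k P _, le_rfl]
  · split_ifs
    exacts [le_rfl, localTerm_nonneg k P _]

theorem primeTail_nonneg (k X : ℕ) (P : PrimePoly F) : 0 ≤ primeTail k X P.1 := by
  refine tsum_nonneg fun m => ?_
  split_ifs
  exacts [localTerm_nonneg k P _, le_rfl]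

theorem primeTail_le (k X : ℕ) (P : PrimePoly F) :
    primeTail k X P.1 ≤ quadraticConst k * ((absV P.1)⁻¹) ^ 2 := by
  refine le_trans ?_ (tsum_localTerm_add_two_le k P)
  refine (summable_primeTail k X P).tsum_le_tsum (fun m => ?_)
    ((summable_nat_add_iff 2).2 (summable_localTerm k P))
  split_ifs
  exacts [le_rfl, localTerm_nonneg k P _]

theorem tendsto_primeTail (k : ℕ) (P : PrimePoly F) :
    Tendsto (fun X => primeTail k X P.1) atTop (nhds 0) := by
  have h := tendsto_tsum_of_dominated_convergence
    (f := fun X m => if X < (m + 2) * P.1.natDegree then localTerm k P.1 (m + 2) else 0)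
    (g := fun _ => (0 : ℝ)) (𝓕 := atTop)
    ((summable_nat_add_iff 2).2 (summable_localTerm k P)) (fun m => ?_)
    (Eventually.of_forall fun X m => ?_)
  · rw [tsum_zero] at h
    exact h
  · refine tendsto_const_nhds.congr' ?_
    filter_upwards [eventually_ge_atTop ((m + 2) * P.1.natDegree)] with X hX
    rw [if_neg (by omega)]
  · split_ifs
    · rw [Real.norm_of_nonneg (localTerm_nonneg k P _)]
    · rw [norm_zero]; exact localTerm_nonneg k P _

variable (F) in
/-- The sum of `primeTail` over all primes. -/
def totalTail (k X : ℕ) : ℝ := ∑' P : PrimePoly F, primeTail k X P.1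

theorem summable_totalTail (k X : ℕ) : Summable fun P : PrimePoly F => primeTail k X P.1 :=
  (summable_prime_inv_sq.mul_left _).of_nonneg_of_le (fun P => primeTail_nonneg k X P)
    fun P => primeTail_le k X P

/-- Each prime's tail tends to `0` and is dominated by a multiple of `|P|^(-2)`, uniformly in `X`.
-/
theorem tendsto_totalTail (k : ℕ) : Tendsto (totalTail F k) atTop (nhds 0) := by
  have h := tendsto_tsum_of_dominated_convergence
    (f := fun X (P : PrimePoly F) => primeTail k X P.1)
    (g := fun _ => (0 : ℝ)) (𝓕 := atTop)
    ((summable_prime_inv_sq (F := F)).mul_left (quadraticConst k))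
    (fun P => tendsto_primeTail k P)
    (Eventually.of_forall fun X P => ?_)
  · rw [tsum_zero] at h
    exact h
  · rw [Real.norm_of_nonneg (primeTail_nonneg k X P)]
    exact primeTail_le k X P

theorem sum_primeTail_le (k X : ℕ) {s : Finset F[X]} (hs : s ⊆ primesLE F X) :
    ∑ P ∈ s, primeTail k X P ≤ totalTail F k X := by
  classical
  rw [← Finset.sum_subtype_of_mem (p := fun P => P.Monic ∧ Irreducible P) (primeTail k X)
    fun P hP => (mem_primesLE.1 (hs hP)).1]
  exact (summable_totalTail k X).sum_le_tsum _ fun P _ => primeTail_nonneg k X P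

/-- At each prime the truncated coefficients agree with `d_k` when `n deg P ≤ X`. This covers `n =
0` and `n = 1` since `deg P ≤ X`, so the local defect is at most `primeTail`; the defects add up by
`one_sub_sum_le_prod`, with a bound free of `R`. -/
theorem one_sub_totalTail_le (k X : ℕ) (R : F[X]) :
    1 - totalTail F k X ≤ diagonalTerm k X R / ∏ P ∈ coprimePrimesLE X R, localSeries k P ∧
      diagonalTerm k X R / ∏ P ∈ coprimePrimesLE X R, localSeries k P ≤ 1 := by
  set A : F[X] → ℝ := fun P => ∑' n, expCoeff k (X / P.natDegree) n ^ 2 / absV P ^ n with hA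
  have hS : ∀ P ∈ coprimePrimesLE X R, (P.Monic ∧ Irreducible P) ∧ P.natDegree ≤ X := fun P hP =>
    mem_primesLE.1 (mem_coprimePrimesLE.1 hP).1
  have hsum : ∀ P ∈ coprimePrimesLE X R,
      Summable fun n => expCoeff k (X / P.natDegree) n ^ 2 / absV P ^ n := by
    intro P hP
    refine (summable_expCoeff_sq k (X / P.natDegree)
        (inv_nonneg.2 (absV_pos (hS P hP).1.2.ne_zero).le)).congr fun n => ?_
    rw [inv_pow, div_eq_mul_inv]
  have hle : ∀ P ∈ coprimePrimesLE X R, ∀ n,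
      expCoeff k (X / P.natDegree) n ^ 2 / absV P ^ n ≤ localTerm k P n := by
    intro P hP n
    have := prime_inv_pos ⟨P, (hS P hP).1⟩
    rw [localTerm_eq k ⟨P, (hS P hP).1⟩, inv_pow, ← div_eq_mul_inv]
    have hpos := absV_pos (hS P hP).1.2.ne_zero
    gcongr
    · exact expCoeff_nonneg _ _ _
    · exact expCoeff_le _ _ _
  have h0 : ∀ P ∈ coprimePrimesLE X R, 0 ≤ A P := fun P hP => tsum_nonneg fun n =>
    div_nonneg (sq_nonneg _) (pow_nonneg (absV_pos (hS P hP).1.2.ne_zero).le _)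
  have h1 : ∀ P ∈ coprimePrimesLE X R, A P ≤ localSeries k P := fun P hP =>
    (hsum P hP).tsum_le_tsum (hle P hP) (summable_localTerm k ⟨P, (hS P hP).1⟩)
  have h2 : ∀ P ∈ coprimePrimesLE X R, localSeries k P - A P ≤ primeTail k X P := by
    intro P hP
    have hs := summable_localTerm k ⟨P, (hS P hP).1⟩
    have hdeg := (hS P hP).1.2.natDegree_pos
    have heq : ∀ n, n * P.natDegree ≤ X →
        localTerm k P n - expCoeff k (X / P.natDegree) n ^ 2 / absV P ^ n = 0 := by
      intro n hn
      rw [expCoeff_eq ((Nat.le_div_iff_mul_le hdeg).2 hn), localTerm,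
        divisorFn_prime_pow k (hS P hP).1, sub_self]
    rw [hA, localSeries, ← hs.tsum_sub (hsum P hP),
      ← (hs.sub (hsum P hP)).sum_add_tsum_nat_add 2, Finset.sum_range_succ, Finset.sum_range_one,
      heq 0 (by omega), heq 1 (by rw [one_mul]; exact (hS P hP).2), zero_add, zero_add]
    refine ((summable_nat_add_iff 2).2 (hs.sub (hsum P hP))).tsum_le_tsum (fun m => ?_)
      (summable_primeTail k X ⟨P, (hS P hP).1⟩)
    dsimp only
    split_ifs with h
    · exact sub_le_self _ (div_nonneg (sq_nonneg _)
        (pow_nonneg (absV_pos (hS P hP).1.2.ne_zero).le _))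
    · exact (heq _ (not_lt.1 h)).le
  have h3 : ∀ P ∈ coprimePrimesLE X R, 1 ≤ localSeries k P := fun P hP =>
    one_le_localSeries k ⟨P, (hS P hP).1⟩
  have h4 : diagonalTerm k X R / ∏ P ∈ coprimePrimesLE X R, localSeries k P =
      ∏ P ∈ coprimePrimesLE X R, (1 - (1 - A P / localSeries k P)) := by
    rw [diagonalTerm, ← Finset.prod_div_distrib]
    exact Finset.prod_congr rfl fun P _ => by rw [sub_sub_cancel]
  have h5 : ∀ P ∈ coprimePrimesLE X R, 0 ≤ 1 - A P / localSeries k P := fun P hP => by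
    rw [sub_nonneg, div_le_one (by linarith [h3 P hP])]
    exact h1 P hP
  have h6 : ∀ P ∈ coprimePrimesLE X R, 1 - A P / localSeries k P ≤ 1 := fun P hP =>
    sub_le_self _ (div_nonneg (h0 P hP) (by linarith [h3 P hP]))
  have h7 : ∀ P ∈ coprimePrimesLE X R, 1 - A P / localSeries k P ≤ primeTail k X P := by
    intro P hP
    have hL : 0 < localSeries k P := by linarith [h3 P hP]
    rw [one_sub_div hL.ne', div_le_iff₀ hL]
    exact (h2 P hP).trans (le_mul_of_one_le_right
      (primeTail_nonneg k X ⟨P, (hS P hP).1⟩) (h3 P hP))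
  rw [h4]
  refine ⟨?_, Finset.prod_le_one (fun P hP => by linarith [h6 P hP]) fun P hP => by
    linarith [h5 P hP]⟩
  refine le_trans ?_ (one_sub_sum_le_prod _ _ h5 h6)
  refine sub_le_sub_left ((Finset.sum_le_sum h7).trans ?_) 1
  exact sum_primeTail_le k X fun P hP => (mem_coprimePrimesLE.1 hP).1

/-- This lower bound makes an absolute error that tends to `0` a relative one. -/
theorem one_le_diagonalTerm (k X : ℕ) (R : F[X]) : 1 ≤ diagonalTerm k X R := by
  rw [diagonalTerm, ← Finset.prod_const_one (s := coprimePrimesLE X R)]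
  refine Finset.prod_le_prod (fun _ _ => zero_le_one) fun P hP => ?_
  have hpos := absV_pos (mem_primesLE.1 (mem_coprimePrimesLE.1 hP).1).1.2.ne_zero
  have hs : Summable fun n => expCoeff k (X / P.natDegree) n ^ 2 / absV P ^ n := by
    refine (summable_expCoeff_sq k (X / P.natDegree) (inv_nonneg.2 hpos.le)).congr fun n => ?_
    rw [inv_pow, div_eq_mul_inv]
  have := hs.le_tsum 0 fun n _ => by positivity
  simpa [expCoeff_zero] using this

/-! ### Convergence and positivity of the arithmetic factor -/

/-- With `r = 1 / |P|`, the linear terms of `(1 - r)^(k²) = 1 - k² r + O(r²)` and of the local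
series `1 + k² r + O(r²)` cancel. -/
theorem abs_arithmeticTerm_sub_one_le (k : ℕ) : ∃ C : ℝ, ∀ P : PrimePoly F,
    |arithmeticTerm k P.1 - 1| ≤ C * ((absV P.1)⁻¹) ^ 2 := by
  set K : ℝ := (k : ℝ) ^ 2 with hK
  have hK0 : 0 ≤ K := by positivity
  set B := quadraticConst k with hB
  have hB0 : 0 ≤ B := quadraticConst_nonneg k
  refine ⟨K ^ 2 * (1 + K + B) + K ^ 2 + (1 + K) * B, fun P => ?_⟩
  set r := (absV P.1)⁻¹ with hr
  have hr0 : 0 < r := prime_inv_pos P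
  have hr1 : r ≤ 1 / 2 := prime_inv_le_half P
  set T := ∑' m, localTerm k P.1 (m + 2) with hT
  have hT0 : 0 ≤ T := tsum_nonneg fun m => localTerm_nonneg k P _
  have hT1 : T ≤ B * r ^ 2 := tsum_localTerm_add_two_le k P
  have hL : localSeries k P.1 = 1 + K * r + T := localSeries_eq k P
  obtain ⟨h1, h2⟩ := one_sub_pow_bounds (k ^ 2) hr0.le (by linarith)
  rw [Nat.cast_pow, ← hK] at h1 h2
  have hr2 : r ^ 2 ≤ 1 := by nlinarith
  have hTB : T ≤ B := hT1.trans (mul_le_of_le_one_right hB0 hr2)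
  have hKr : K * r ≤ K := mul_le_of_le_one_right hK0 (by linarith)
  have hKr0 : 0 ≤ K * r := mul_nonneg hK0 hr0.le
  set E := (1 - r) ^ (k ^ 2) - (1 - K * r) with hE
  have hE0 : 0 ≤ E := by linarith
  have hE1 : E ≤ K ^ 2 * r ^ 2 := by linarith
  have hid : arithmeticTerm k P.1 - 1 = E * (1 + K * r + T) - K ^ 2 * r ^ 2 + (1 - K * r) * T := by
    rw [arithmeticTerm, hL, one_div, ← hr, show (1 - r) ^ (k ^ 2) = E + (1 - K * r) by
      rw [hE]; ring]
    ring
  have h3 : E * (1 + K * r + T) ≤ K ^ 2 * r ^ 2 * (1 + K + B) :=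
    mul_le_mul hE1 (by linarith) (by linarith) (by positivity)
  have h3' : 0 ≤ E * (1 + K * r + T) := mul_nonneg hE0 (by linarith)
  have h4 : |(1 - K * r) * T| ≤ (1 + K) * (B * r ^ 2) := by
    rw [abs_mul, abs_of_nonneg hT0]
    refine mul_le_mul ?_ hT1 hT0 (by linarith)
    rw [abs_le]
    constructor <;> linarith
  have h5 : 0 ≤ K ^ 2 * r ^ 2 := by positivity
  rw [hid]
  rw [abs_le] at h4 ⊢
  constructor <;> nlinarith

theorem arithmeticTerm_pos (k : ℕ) (P : PrimePoly F) : 0 < arithmeticTerm k P.1 := by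
  have h1 := prime_inv_le_half P
  have h2 := one_le_localSeries k P
  rw [arithmeticTerm, one_div]
  have : 0 < 1 - (absV P.1)⁻¹ := by linarith
  positivity

theorem summable_arithmeticTerm_sub_one (k : ℕ) :
    Summable fun P : PrimePoly F => arithmeticTerm k P.1 - 1 := by
  obtain ⟨C, hC⟩ := abs_arithmeticTerm_sub_one_le (F := F) k
  exact Summable.of_norm_bounded (summable_prime_inv_sq.mul_left C) hC

theorem multipliable_arithmeticTerm (k : ℕ) :
    Multipliable fun P : PrimePoly F => arithmeticTerm k P.1 := by
  have := Real.multipliable_one_add_of_summable (summable_arithmeticTerm_sub_one (F := F) k)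
  simpa using this

theorem arithmeticFactor_pos (k : ℕ) : 0 < arithmeticFactor F k := by
  have h := Real.summable_log_one_add_of_summable (summable_arithmeticTerm_sub_one (F := F) k)
  simp only [add_sub_cancel] at h
  rw [arithmeticFactor, ← Real.rexp_tsum_eq_tprod (fun P => arithmeticTerm_pos k P) h]
  exact Real.exp_pos _

theorem tendsto_prod_arithmeticTerm (k : ℕ) :
    Tendsto (fun X => ∏ P ∈ primesLE F X, arithmeticTerm k P) atTop
      (nhds (arithmeticFactor F k)) := by
  classical
  have h := (multipliable_arithmeticTerm (F := F) k).hasProd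
  have h2 : Tendsto (fun X => (primesLE F X).subtype (fun P => P.Monic ∧ Irreducible P))
      atTop atTop := by
    refine tendsto_atTop_finset_of_monotone (fun X Y hXY P hP => ?_) fun P => ?_
    · rw [Finset.mem_subtype, mem_primesLE] at hP ⊢
      exact ⟨hP.1, hP.2.trans hXY⟩
    · exact ⟨P.1.natDegree, Finset.mem_subtype.2 (mem_primesLE.2 ⟨P.2, le_rfl⟩)⟩
  refine (Tendsto.comp h h2).congr fun X => ?_
  exact Finset.prod_subtype_of_mem _ fun P hP => (mem_primesLE.1 hP).1

/-! ### Mertens' theorem -/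

/-- The logarithm of the Mertens product over the primes of degree at most `X`. -/
def mertensSum (F : Type*) [Field F] [Fintype F] (X : ℕ) : ℝ :=
  ∑ P ∈ primesLE F X, -Real.log (1 - (absV P)⁻¹)

/-- Keeping only powers of degree at most `X` in the logarithmic series gives exactly `∑_{n ≤ X}
1/n`, by the count of prime powers. The omitted powers are nonnegative and bounded by the tails for
`k = 1`. -/
theorem mertensSum_bounds (X : ℕ) : (harmonic X : ℝ) ≤ mertensSum F X ∧
    mertensSum F X ≤ harmonic X + totalTail F 1 X := by
  have hq := two_le_card (F := F)
  have hq0 : (0 : ℝ) < Fintype.card F := by linarith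
  have hH : (harmonic X : ℝ) = ∑ P ∈ primesLE F X, ∑ j ∈ Finset.range (X / P.natDegree),
      ((absV P)⁻¹) ^ (j + 1) / (j + 1) := by
    have h := sum_primes_sum_powers (F := F) X fun n : ℕ => ((Fintype.card F : ℝ)⁻¹) ^ n
    have h1 : ∑ n ∈ Finset.range X, ((Fintype.card F : ℝ)⁻¹) ^ (n + 1) *
          (Fintype.card F : ℝ) ^ (n + 1) / (n + 1) = (harmonic X : ℝ) := by
      rw [harmonic]
      push_cast
      refine Finset.sum_congr rfl fun n _ => ?_
      rw [← mul_pow, inv_mul_cancel₀ hq0.ne', one_pow, one_div]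
    rw [← h1, ← h]
    refine Finset.sum_congr rfl fun P hP => Finset.sum_congr rfl fun j _ => ?_
    rw [absV_eq (mem_primesLE.1 hP).1.2.ne_zero, ← inv_pow, ← pow_mul, mul_comm]
  have key : ∀ P ∈ primesLE F X,
      ∑ j ∈ Finset.range (X / P.natDegree), ((absV P)⁻¹) ^ (j + 1) / (j + 1) ≤
        -Real.log (1 - (absV P)⁻¹) ∧ -Real.log (1 - (absV P)⁻¹) ≤
        ∑ j ∈ Finset.range (X / P.natDegree), ((absV P)⁻¹) ^ (j + 1) / (j + 1) +
          primeTail 1 X P := by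
    intro P hP
    obtain ⟨hP1, hP2⟩ := mem_primesLE.1 hP
    have hdeg := hP1.2.natDegree_pos
    have h0 := prime_inv_pos ⟨P, hP1⟩
    have h1 := prime_inv_le_half ⟨P, hP1⟩
    dsimp only at h0 h1
    have hs := Real.hasSum_pow_div_log_of_abs_lt_one (x := (absV P)⁻¹)
      (by rw [abs_of_pos h0]; linarith)
    -- The omitted powers start at exponent `J + 2`, which is index `J` in `primeTail`, whose index
    -- `m` stands for exponent `m + 2`.
    obtain ⟨J, hJ⟩ : ∃ J, X / P.natDegree = J + 1 :=
      ⟨X / P.natDegree - 1, (Nat.sub_add_cancel (Nat.div_pos hP2 hdeg)).symm⟩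
    rw [← hs.tsum_eq, ← hs.summable.sum_add_tsum_nat_add (X / P.natDegree), hJ]
    refine ⟨le_add_of_nonneg_right (tsum_nonneg fun j => by positivity),
      add_le_add_right ?_ _⟩
    have ht := summable_primeTail 1 X ⟨P, hP1⟩
    dsimp only at ht
    have hnn : ∀ m, 0 ≤ if X < (m + 2) * P.natDegree then localTerm 1 P (m + 2) else 0 := by
      intro m
      split_ifs
      exacts [localTerm_nonneg 1 ⟨P, hP1⟩ _, le_rfl]
    rw [primeTail, ← ht.sum_add_tsum_nat_add J]
    refine le_trans ?_ (le_add_of_nonneg_left (Finset.sum_nonneg fun m _ => hnn m))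
    have hs1 := (summable_nat_add_iff (J + 1)).2 hs.summable
    have ht1 := (summable_nat_add_iff J).2 ht
    refine hs1.tsum_le_tsum (fun m => ?_) ht1
    have hlt : X < (m + J + 2) * P.natDegree := by
      have := (Nat.div_lt_iff_lt_mul hdeg (x := X) (y := J + 2)).1 (by omega)
      exact this.trans_le (Nat.mul_le_mul_right _ (by omega))
    rw [if_pos hlt, localTerm_eq 1 ⟨P, hP1⟩, show m + (J + 1) + 1 = m + J + 2 by ring]
    have h3 : (1 : ℝ) ≤ (Nat.multichoose 1 (m + J + 2) : ℝ) ^ 2 := by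
      refine one_le_pow₀ ?_
      exact_mod_cast one_le_multichoose one_pos (m + J + 2)
    dsimp only
    refine (div_le_self (by positivity) ?_).trans (le_mul_of_one_le_left (by positivity) h3)
    have : (0 : ℝ) ≤ ((m + (J + 1) : ℕ) : ℝ) := Nat.cast_nonneg _
    linarith
  rw [hH, mertensSum]
  refine ⟨Finset.sum_le_sum fun P hP => (key P hP).1, ?_⟩
  refine (Finset.sum_le_sum fun P hP => (key P hP).2).trans ?_
  rw [Finset.sum_add_distrib]
  exact add_le_add_right (sum_primeTail_le 1 X subset_rfl) _

theorem tendsto_mertensSum_sub_log : Tendsto (fun X : ℕ => mertensSum F X - Real.log X) atTop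
    (nhds Real.eulerMascheroniConstant) := by
  have h1 := Real.tendsto_harmonic_sub_log
  have h2 := h1.add (tendsto_totalTail (F := F) 1)
  rw [add_zero] at h2
  refine tendsto_of_tendsto_of_tendsto_of_le_of_le h1 h2 (fun X => ?_) fun X => ?_
  · exact sub_le_sub_right (mertensSum_bounds X).1 _
  · have := (mertensSum_bounds (F := F) X).2
    dsimp only
    linarith

theorem prod_localSeries_eq (k X : ℕ) : ∏ P ∈ primesLE F X, localSeries k P =
    (∏ P ∈ primesLE F X, arithmeticTerm k P) * Real.exp (mertensSum F X) ^ (k ^ 2) := by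
  rw [mertensSum, Real.exp_sum, ← Finset.prod_pow, ← Finset.prod_mul_distrib]
  refine Finset.prod_congr rfl fun P hP => ?_
  have h1 := prime_inv_le_half ⟨P, (mem_primesLE.1 hP).1⟩
  dsimp only at h1
  have h2 : 0 < 1 - (absV P)⁻¹ := by linarith
  rw [arithmeticTerm, one_div, Real.exp_neg, Real.exp_log h2, inv_pow, mul_right_comm,
    mul_inv_cancel₀ (pow_pos h2 _).ne', one_mul]

/-- Mertens' theorem for the local series. -/
theorem tendsto_prod_localSeries_div (k : ℕ) : Tendsto (fun X : ℕ =>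
    (∏ P ∈ primesLE F X, localSeries k P) / (arithmeticFactor F k *
      (Real.exp Real.eulerMascheroniConstant * X) ^ (k ^ 2))) atTop (nhds 1) := by
  have ha := (arithmeticFactor_pos (F := F) k).ne'
  have h1 := (tendsto_prod_arithmeticTerm (F := F) k).div_const (arithmeticFactor F k)
  rw [div_self ha] at h1
  have h2 := ((Real.continuous_exp.tendsto _).comp ((tendsto_mertensSum_sub_log (F := F)).sub_const
    Real.eulerMascheroniConstant)).pow (k ^ 2)
  rw [sub_self, Real.exp_zero, one_pow] at h2
  have h3 := h1.mul h2
  rw [mul_one] at h3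
  refine h3.congr' ?_
  filter_upwards [eventually_gt_atTop 0] with X hX
  have hX' : (0 : ℝ) < X := by exact_mod_cast hX
  rw [prod_localSeries_eq]
  simp only [Function.comp]
  rw [Real.exp_sub, Real.exp_sub, Real.exp_log hX', mul_div_mul_comm, ← div_pow, div_div,
    mul_comm (X : ℝ)]

/-- The primes dividing `R` cancel from the full product over `deg P ≤ X`, so the main term is the
product over `P ∤ R` up to the Mertens ratio, which tends to `1`. -/
theorem mainTerm_eq (k X : ℕ) (R : MonicPoly F) :
    mainTerm k X R = (∏ P ∈ coprimePrimesLE X R.1, localSeries k P) *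
      ((∏ P ∈ primesLE F X, localSeries k P) / (arithmeticFactor F k *
        (Real.exp Real.eulerMascheroniConstant * X) ^ (k ^ 2)))⁻¹ := by
  classical
  have hL : ∀ P ∈ primesLE F X, localSeries k P ≠ 0 := fun P hP =>
    (zero_lt_one.trans_le (one_le_localSeries k ⟨P, (mem_primesLE.1 hP).1⟩)).ne'
  have h1 : ∏ P ∈ primesLE F X, localSeries k P =
      (∏ P ∈ (primesLE F X).filter (fun P => P ∣ R.1), localSeries k P) *
        ∏ P ∈ coprimePrimesLE X R.1, localSeries k P := by
    rw [← Finset.prod_filter_mul_prod_filter_not (primesLE F X) (fun P => P ∣ R.1)]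
    congr 1
  have h2 : ∏ P ∈ coprimePrimesLE X R.1, localSeries k P ≠ 0 :=
    Finset.prod_ne_zero_iff.2 fun P hP => hL P (mem_coprimePrimesLE.1 hP).1
  have h3 : ∏ P ∈ (primesLE F X).filter (fun P => P ∣ R.1), localSeries k P ≠ 0 :=
    Finset.prod_ne_zero_iff.2 fun P hP => hL P (Finset.mem_filter.1 hP).1
  rw [h1, inv_div, mainTerm, Finset.prod_inv_distrib]
  -- The two filters differ only in their decidability instances.
  have h4 : ∏ P ∈ (primesLE F X).filter (fun P => P ∣ R.1), localSeries k P =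
    ∏ P ∈ @Finset.filter _ (fun P => P ∣ R.1) (fun P => Classical.propDecidable _) (primesLE F X),
      localSeries k P := by
    refine Finset.prod_congr ?_ fun _ _ => rfl
    ext P
    simp only [Finset.mem_filter]
  rw [← h4]
  field_simp

/-! ### The limit in the regime `X ≤ log_q deg R` -/

/-- The bound for the off-diagonal terms, as a function of `n = deg R`. -/
theorem tendsto_offDiagonal_bound (k : ℕ) : Tendsto (fun n : ℕ => linearPrimesFactor F *
    Real.exp (2 * k * (Real.logb (Fintype.card F) n * (n : ℝ) ^ (3 / 4 : ℝ)) -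
      Real.log (Fintype.card F) / 4 * n)) atTop (nhds 0) := by
  have hq := two_le_card (F := F)
  set l := Real.log (Fintype.card F) with hl
  have hl0 : 0 < l := Real.log_pos (by linarith)
  rw [← mul_zero (linearPrimesFactor F)]
  refine Tendsto.const_mul _ (Real.tendsto_exp_atBot.comp ?_)
  have h1 : Tendsto (fun n : ℕ => -(l / 8 * (n : ℝ))) atTop atBot :=
    tendsto_neg_atTop_atBot.comp
      (tendsto_natCast_atTop_atTop.const_mul_atTop (by positivity))
  refine tendsto_atBot_mono' _ ?_ h1
  -- The constant makes the growing term at most `(l/8) n`, half of the decay `(l/4) n`: one factor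
  -- `l` converts `log` to `log_q`, and `2k + 1` in place of `2k` avoids division by zero.
  have h2 : ∀ᶠ n : ℕ in atTop, ‖Real.log n‖ ≤
      (l * (l / 8) / (2 * k + 1)) * ‖(n : ℝ) ^ (1 / 4 : ℝ)‖ :=
    ((isLittleO_log_rpow_atTop (r := 1 / 4) (by norm_num)).comp_tendsto
      tendsto_natCast_atTop_atTop).def (by positivity)
  filter_upwards [h2, eventually_gt_atTop 0] with n hn hn0
  have hn1 : (1 : ℝ) ≤ n := by exact_mod_cast hn0
  have hlog : 0 ≤ Real.log n := Real.log_nonneg hn1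
  rw [Real.norm_of_nonneg hlog, Real.norm_of_nonneg (by positivity)] at hn
  have h3 : (n : ℝ) ^ (1 / 4 : ℝ) * (n : ℝ) ^ (3 / 4 : ℝ) = n := by
    rw [← Real.rpow_add (by linarith)]; norm_num
  have h4 : (2 * k + 1) * Real.log n ≤ l * (l / 8) * (n : ℝ) ^ (1 / 4 : ℝ) := by
    have hk : (0 : ℝ) < 2 * k + 1 := by positivity
    have := mul_le_mul_of_nonneg_left hn hk.le
    refine this.trans (le_of_eq ?_)
    field_simp
  have h5 : 2 * k * Real.logb (Fintype.card F) n ≤ l / 8 * (n : ℝ) ^ (1 / 4 : ℝ) := by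
    rw [Real.logb, ← hl, mul_div_assoc', div_le_iff₀ hl0]
    calc 2 * k * Real.log n ≤ (2 * k + 1) * Real.log n :=
          mul_le_mul_of_nonneg_right (by linarith) hlog
      _ ≤ _ := h4
      _ = _ := by ring
  have h6 : 2 * k * (Real.logb (Fintype.card F) n * (n : ℝ) ^ (3 / 4 : ℝ)) ≤ l / 8 * n := by
    calc 2 * k * (Real.logb (Fintype.card F) n * (n : ℝ) ^ (3 / 4 : ℝ))
        = (2 * k * Real.logb (Fintype.card F) n) * (n : ℝ) ^ (3 / 4 : ℝ) := by ring
      _ ≤ (l / 8 * (n : ℝ) ^ (1 / 4 : ℝ)) * (n : ℝ) ^ (3 / 4 : ℝ) :=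
          mul_le_mul_of_nonneg_right h5 (by positivity)
      _ = l / 8 * n := by rw [mul_assoc, h3]
  linarith

theorem abs_eulerMoment_sub_diagonalTerm_le_of_le_logb (k X : ℕ) (R : MonicPoly F)
    (hne : (primitiveChars R).Nonempty) (hdeg : 0 < R.1.natDegree)
    (hX : (X : ℝ) ≤ Real.logb (Fintype.card F) R.1.natDegree) :
    |eulerMoment k X R - diagonalTerm k X R.1| ≤ linearPrimesFactor F *
    Real.exp (2 * k * (Real.logb (Fintype.card F) R.1.natDegree *
      (R.1.natDegree : ℝ) ^ (3 / 4 : ℝ)) - Real.log (Fintype.card F) / 4 * R.1.natDegree) := by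
  have hq := two_le_card (F := F)
  have hq0 : (0 : ℝ) < Fintype.card F := by linarith
  refine (abs_eulerMoment_sub_diagonalTerm_le k X R hne).trans ?_
  rw [mul_assoc]
  refine mul_le_mul_of_nonneg_left ?_ linearPrimesFactor_pos.le
  have h1 : (absV R.1 ^ (1 / 4 : ℝ))⁻¹ =
      Real.exp (-(Real.log (Fintype.card F) / 4 * R.1.natDegree)) := by
    rw [absV_eq R.2.ne_zero, Real.exp_neg, ← Real.rpow_natCast, ← Real.rpow_mul hq0.le,
      Real.rpow_def_of_pos hq0]
    congr 2
    ring
  have h2 : (Fintype.card F : ℝ) ^ X ≤ R.1.natDegree := by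
    have := (Real.le_logb_iff_rpow_le (by linarith) (by exact_mod_cast hdeg)).1 hX
    rwa [Real.rpow_natCast] at this
  rw [h1, ← Real.exp_nat_mul, ← Real.exp_add, Real.exp_le_exp]
  have h3 : X * ((Fintype.card F : ℝ) ^ X) ^ (3 / 4 : ℝ) ≤
      Real.logb (Fintype.card F) R.1.natDegree * (R.1.natDegree : ℝ) ^ (3 / 4 : ℝ) :=
    mul_le_mul hX (Real.rpow_le_rpow (by positivity) h2 (by norm_num)) (by positivity)
      (le_trans (Nat.cast_nonneg _) hX)
  have h4 := mul_le_mul_of_nonneg_left h3 (by positivity : (0 : ℝ) ≤ 2 * k)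
  push_cast
  linarith

theorem tendsto_regime : Tendsto (fun p : ℕ × MonicPoly F => (p.1, p.2.1.natDegree)) (regime F)
    (atTop ×ˢ atTop) :=
  tendsto_comap.mono_left inf_le_left

theorem tendsto_fst_regime : Tendsto (fun p : ℕ × MonicPoly F => p.1) (regime F) atTop :=
  (tendsto_fst (f := (atTop : Filter ℕ)) (g := (atTop : Filter ℕ))).comp tendsto_regime

theorem tendsto_natDegree_regime :
    Tendsto (fun p : ℕ × MonicPoly F => p.2.1.natDegree) (regime F) atTop :=
  (tendsto_snd (f := (atTop : Filter ℕ)) (g := (atTop : Filter ℕ))).comp tendsto_regime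

theorem eventually_regime : ∀ᶠ p : ℕ × MonicPoly F in regime F,
    (p.1 : ℝ) ≤ Real.logb (Fintype.card F) p.2.1.natDegree ∧ (primitiveChars p.2).Nonempty :=
  eventually_inf_principal.2 (Eventually.of_forall fun _ h => h)

theorem eulerMoment_isEquivalent_diagonalTerm (k : ℕ) :
    (fun p : ℕ × MonicPoly F => eulerMoment k p.1 p.2) ~[regime F]
      (fun p => diagonalTerm k p.1 p.2.1) := by
  refine IsLittleO.of_bound fun c hc => ?_
  have h := ((tendsto_offDiagonal_bound (F := F) k).comp (tendsto_natDegree_regime (F := F))).eventually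
    (eventually_le_nhds hc)
  filter_upwards [h, eventually_regime, (tendsto_natDegree_regime (F := F)).eventually_gt_atTop 0]
    with p h1 ⟨h2, h3⟩ h4
  have h5 := one_le_diagonalTerm k p.1 p.2.1
  rw [Pi.sub_apply, Real.norm_eq_abs, Real.norm_of_nonneg (by linarith)]
  refine (abs_eulerMoment_sub_diagonalTerm_le_of_le_logb k p.1 p.2 h3 h4 h2).trans ?_
  exact le_trans h1 (le_mul_of_one_le_right hc.le h5)

/-- The quotient is the diagonal over the full local series at `P ∤ R`, times the Mertens ratio. The
first is squeezed by `one_sub_totalTail_le` and the second depends only on `X`, so both tend to `1`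
uniformly in `R`. -/
theorem diagonalTerm_isEquivalent_mainTerm (k : ℕ) :
    (fun p : ℕ × MonicPoly F => diagonalTerm k p.1 p.2.1) ~[regime F]
      (fun p => mainTerm k p.1 p.2) := by
  rw [isEquivalent_iff_exists_eq_mul]
  refine ⟨fun p => diagonalTerm k p.1 p.2.1 / (∏ P ∈ coprimePrimesLE p.1 p.2.1, localSeries k P) *
    ((∏ P ∈ primesLE F p.1, localSeries k P) / (arithmeticFactor F k *
        (Real.exp Real.eulerMascheroniConstant * p.1) ^ (k ^ 2))), ?_, ?_⟩
  · rw [← mul_one (1 : ℝ)]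
    refine Tendsto.mul ?_ ((tendsto_prod_localSeries_div k).comp tendsto_fst_regime)
    have h1 := (tendsto_totalTail (F := F) k).const_sub 1
    rw [sub_zero] at h1
    exact tendsto_of_tendsto_of_tendsto_of_le_of_le (h1.comp tendsto_fst_regime)
      tendsto_const_nhds (fun p => (one_sub_totalTail_le k p.1 p.2.1).1)
      fun p => (one_sub_totalTail_le k p.1 p.2.1).2
  · filter_upwards [tendsto_fst_regime.eventually_gt_atTop 0] with p hp
    have hp' : (0 : ℝ) < p.1 := by exact_mod_cast hp
    have h1 : ∏ P ∈ coprimePrimesLE p.1 p.2.1, localSeries k P ≠ 0 :=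
      Finset.prod_ne_zero_iff.2 fun P hP => (zero_lt_one.trans_le (one_le_localSeries k
        ⟨P, (mem_primesLE.1 (mem_coprimePrimesLE.1 hP).1).1⟩)).ne'
    have h2 : (∏ P ∈ primesLE F p.1, localSeries k P) / (arithmeticFactor F k *
        (Real.exp Real.eulerMascheroniConstant * p.1) ^ (k ^ 2)) ≠ 0 := by
      refine div_ne_zero (Finset.prod_ne_zero_iff.2 fun P hP => (zero_lt_one.trans_le
        (one_le_localSeries k ⟨P, (mem_primesLE.1 hP).1⟩)).ne') ?_
      have := arithmeticFactor_pos (F := F) k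
      positivity
    rw [Pi.mul_apply, mainTerm_eq, mul_mul_mul_comm, mul_inv_cancel₀ h2, mul_one,
      div_mul_cancel₀ _ h1]

end FqPoly

end

theorem theorem2 {F : Type*} [Field F] [Fintype F] (k : ℕ) (hk : 0 < k) :
    (∀ P : FqPoly.PrimePoly F, Summable (FqPoly.localTerm k P.1)) ∧
    Multipliable (fun P : FqPoly.PrimePoly F => FqPoly.arithmeticTerm k P.1) ∧
    (fun p : ℕ × FqPoly.MonicPoly F => FqPoly.eulerMoment k p.1 p.2) ~[FqPoly.regime F]
      (fun p => FqPoly.mainTerm k p.1 p.2) :=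
  ⟨fun P => FqPoly.summable_localTerm k P, FqPoly.multipliable_arithmeticTerm k,
    (FqPoly.eulerMoment_isEquivalent_diagonalTerm k).trans
      (FqPoly.diagonalTerm_isEquivalent_mainTerm k)⟩
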